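/- Let $d\ge 2$. A state of a $2\otimes d$ system is a positive semidefinite operator of trace one on $\mathbb{C}^2\otimes\mathbb{C}^d$. A state is separable if it is a finite convex combination of product states $\alpha\otimes\beta$, where $\alpha$ is a state on $\mathbb{C}^2$ and $\beta$ a state on $\mathbb{C}^d$; it is absolutely separable if $U\rho U^\dagger$ is separable for every unitary operator $U$ on $\mathbb{C}^2\otimes\mathbb{C}^d$. Let $\mathbf{AS}$ be the set of absolutely separable states; its interior and boundary are taken relative to the set of all states of the system, with the usual topology. Let $\rho\in\mathbf{AS}$ be different from the maximally mixed state $\mathbb{I}/(2d)$, and let $\lambda_1\ge\lambda_2\ge\dots\ge\lambda_{2d}$ be the eigenvalues of $\rho$, counted with multiplicity. If $$\lambda_1-\lambda_{2d-1}<2\sqrt{\lambda_{2d-2}\,\lambda_{2d}},$$ then there are a boundary point $\sigma$ of $\mathbf{AS}$ that belongs to $\mathbf{AS}$ and a real number $t$ with $0<t<1$ such that $$\rho=t\,\frac{\mathbb{I}}{2d}+(1-t)\,\sigma .$$ Moreover, $\rho$ is an interior point of $\mathbf{AS}$. -/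

import Mathlib

open scoped Kronecker Matrix ComplexOrder

/-- The states (density matrices) of a finite-dimensional quantum system with orthonormal
basis indexed by `n`: positive semidefinite complex matrices of trace one. As a subtype of the
matrices, the set of states carries the usual (Euclidean) topology. -/
abbrev QState (n : Type) [Fintype n] : Type :=
  {ρ : Matrix n n ℂ // ρ.PosSemidef ∧ ρ.trace = 1}

/-- The conjugation `U ρ U†` of a state by a unitary. -/
def QState.conj {n : Type} [Fintype n] [DecidableEq n] (U : Matrix.unitaryGroup n ℂ)
    (ρ : QState n) : QState n :=
  ⟨(U : Matrix n n ℂ) * ρ.1 * (U : Matrix n n ℂ)ᴴ,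
    ρ.2.1.mul_mul_conjTranspose_same _, by
      rw [Matrix.trace_mul_cycle, ← Matrix.star_eq_conjTranspose,
        Matrix.UnitaryGroup.star_mul_self, Matrix.one_mul, ρ.2.2]⟩

/-- A bipartite state is separable if it is a (finite) convex combination of product states
`α ⊗ β`, where `α` and `β` are states of the two subsystems. -/
def QIsSeparable {m n : Type} [Fintype m] [Fintype n] (ρ : QState (m × n)) : Prop :=
  ρ.1 ∈ convexHull ℝ
    {τ : Matrix (m × n) (m × n) ℂ | ∃ (α : QState m) (β : QState n), τ = α.1 ⊗ₖ β.1}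

/-- The set of absolutely separable states in `2 ⊗ d`: the states that remain separable under
every global unitary. It is a subset of the space of all states of the system. -/
def absSep (d : ℕ) : Set (QState (Fin 2 × Fin d)) :=
  {ρ | ∀ U : Matrix.unitaryGroup (Fin 2 × Fin d) ℂ, QIsSeparable (ρ.conj U)}

/-- The maximally mixed state `𝟙 / (2d)` of a `2 ⊗ d` system. -/
noncomputable def maxMixed (d : ℕ) : Matrix (Fin 2 × Fin d) (Fin 2 × Fin d) ℂ :=
  ((2 * d : ℝ)⁻¹) • 1

/-- The `2d` eigenvalues of a `2 ⊗ d` state, with multiplicity, in decreasing order. The index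
starts at `0`, so that the eigenvalue usually written `λ_k` is `decEig ρ (k - 1)`. -/
noncomputable def decEig {d : ℕ} (ρ : QState (Fin 2 × Fin d)) (k : Fin (2 * d)) : ℝ :=
  ρ.2.1.isHermitian.eigenvalues₀ (Fin.cast (by simp) k)

/-! The inequality is an open condition on the spectrum and is invariant under unitaries. So it is
enough to show that, with a little slack, it implies separability: a whole neighbourhood of `ρ` then
lies in `absSep d` (`exists_norm_lt_imp_mem_absSep`).

Write the operator as a `2 × 2` block matrix with blocks `A`, `B`, `Bᴴ`, `C`. If `‖B‖² ≤ λ_min(A)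
λ_min(C)`, it is separable up to slack: splitting off a block diagonal part leaves scalar diagonal
blocks, and a local filter then makes the matrix invariant under partial transposition, where an
explicit product decomposition exists (`blockMatrix_mem`). The domination may fail in the given
basis of `ℂ²`, but some real rotation of that basis achieves it (`SpectralBounds.exists_rotation`).
Let `v`, `w` be bottom eigenvectors of `A`, `C`, and `x`, `y` top singular vectors of `B`. If `|⟨v,
x⟩| = |⟨w, y⟩|`, the eigenvalue inequality, used as positivity of a partial transpose on a
four-dimensional subspace, bounds `‖B‖` as wanted (`SpectralBounds.re_inner_le_sqrt`). A quarter
turn exchanges `v` with `w` and `x` with `y`, so the difference of the two overlaps changes sign,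
and a connectedness argument finds a rotation where it vanishes.

For the boundary point, `absSep d` is compact, so the ray from the maximally mixed state through `ρ`
has a last point `σ` in it, strictly beyond `ρ` because `ρ` is interior. If `σ` were interior and
invertible, the ray could be prolonged; a singular `σ` is never interior, since admixing an
entangled vector next to its kernel destroys separability (`notMem_interior_absSep_of_singular`). -/

/-! ### Real `2 × 2` singular values. -/

/-- Singular value decomposition of a real `2 × 2` matrix with rotations as factors. -/
lemma exists_rotation_svd (m₀₀ m₀₁ m₁₀ m₁₁ : ℝ) : ∃ p q θ φ : ℝ, |q| ≤ p ∧
    m₀₀ = p * (Real.cos θ * Real.cos φ) + q * (Real.sin θ * Real.sin φ) ∧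
    m₀₁ = p * (Real.cos θ * Real.sin φ) - q * (Real.sin θ * Real.cos φ) ∧
    m₁₀ = p * (Real.sin θ * Real.cos φ) - q * (Real.cos θ * Real.sin φ) ∧
    m₁₁ = p * (Real.sin θ * Real.sin φ) + q * (Real.cos θ * Real.cos φ) := by
  -- On `ℝ² = ℂ` the matrix acts as `z ↦ μ z + ν z̄`. Its signed singular values are `‖μ‖ ± ‖ν‖`,
  -- and the two arguments determine the two rotation angles.
  let μ : ℂ := ⟨(m₀₀ + m₁₁) / 2, (m₁₀ - m₀₁) / 2⟩
  let ν : ℂ := ⟨(m₀₀ - m₁₁) / 2, (m₁₀ + m₀₁) / 2⟩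
  obtain ⟨θ, φ, hA, hB⟩ : ∃ θ φ : ℝ, μ.arg = θ - φ ∧ ν.arg = θ + φ :=
    ⟨(μ.arg + ν.arg) / 2, (ν.arg - μ.arg) / 2, by ring, by ring⟩
  have h1 := Complex.norm_mul_cos_arg μ
  have h2 := Complex.norm_mul_sin_arg μ
  have h3 := Complex.norm_mul_cos_arg ν
  have h4 := Complex.norm_mul_sin_arg ν
  rw [hA] at h1 h2
  rw [hB] at h3 h4
  rw [Real.cos_sub] at h1
  rw [Real.sin_sub] at h2
  rw [Real.cos_add] at h3
  rw [Real.sin_add] at h4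
  have e1 : μ.re = (m₀₀ + m₁₁) / 2 := rfl
  have e2 : μ.im = (m₁₀ - m₀₁) / 2 := rfl
  have e3 : ν.re = (m₀₀ - m₁₁) / 2 := rfl
  have e4 : ν.im = (m₁₀ + m₀₁) / 2 := rfl
  rw [e1] at h1; rw [e2] at h2; rw [e3] at h3; rw [e4] at h4
  refine ⟨‖μ‖ + ‖ν‖, ‖μ‖ - ‖ν‖, θ, φ, ?_, ?_, ?_, ?_, ?_⟩
  · rw [abs_le]; constructor <;> linarith [norm_nonneg μ, norm_nonneg ν]
  · linear_combination - h1 - h3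
  · linear_combination h2 - h4
  · linear_combination -h2 - h4
  · linear_combination -h1 + h3

/-! ### From eigenvalue bounds to the partial transpose inequality. -/

section SpectralBounds

variable {H : Type*} [NormedAddCommGroup H] [InnerProductSpace ℂ H]

/-- `T` is symmetric, its largest eigenvalue is at most `l`, and the sums of its one, two and three
smallest eigenvalues are at least `e`, `c + e` and `b + c + e`, in variational form. -/
structure SpectralBounds (T : H →L[ℂ] H) (l b c e : ℝ) : Prop where
  isSymmetric : ∀ u v, inner ℂ u (T v) = inner ℂ (T u) v
  le_top : ∀ u : H, ‖u‖ = 1 → (inner ℂ u (T u)).re ≤ l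
  le_one : ∀ u : H, ‖u‖ = 1 → e ≤ (inner ℂ u (T u)).re
  le_two : ∀ u : Fin 2 → H, Orthonormal ℂ u → c + e ≤ ∑ k, (inner ℂ (u k) (T (u k))).re
  le_three : ∀ u : Fin 3 → H, Orthonormal ℂ u → b + c + e ≤ ∑ k, (inner ℂ (u k) (T (u k))).re

/-- Rearrangement of the weights `p², q², pq, -pq` against the eigenvalue bounds. -/
lemma SpectralBounds.weighted_sum_nonneg {T : H →L[ℂ] H} {l b c e : ℝ}
    (hT : SpectralBounds T l b c e) (hb : 0 ≤ b) (he : 0 ≤ e) (hl : l ≤ c + 2 * √(b * e))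
    {p q : ℝ} (hq : 0 ≤ q) (hqp : q ≤ p) (g : Fin 4 → H) (hg : Orthonormal ℂ g) :
    0 ≤ p ^ 2 * (inner ℂ (g 0) (T (g 0))).re + q ^ 2 * (inner ℂ (g 1) (T (g 1))).re +
      p * q * ((inner ℂ (g 2) (T (g 2))).re - (inner ℂ (g 3) (T (g 3))).re) := by
  have h1 := hT.le_one (g 0) (hg.1 0)
  have h2 := hT.le_two (g ∘ ![0, 2]) (hg.comp _ (by decide))
  have h3 := hT.le_three (g ∘ ![0, 1, 2]) (hg.comp _ (by decide))
  have h4 := hT.le_top (g 3) (hg.1 3)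
  simp only [Fin.sum_univ_succ, Fin.sum_univ_zero, Function.comp] at h2 h3
  simp at h2 h3
  have hp : 0 ≤ p := hq.trans hqp
  have hpq : 0 ≤ p * q := mul_nonneg hp hq
  -- Abel summation: since `p² ≥ pq ≥ q²`, the weights split into nonnegative multiples of the one-,
  -- two- and three-vector sums, leaving `p² e + pq c + q² b - pq l`.
  have k1 : 0 ≤ (p ^ 2 - p * q) * ((inner ℂ (g 0) (T (g 0))).re - e) :=
    mul_nonneg (by nlinarith) (by linarith)
  have k2 := mul_nonneg (show 0 ≤ p * q - q ^ 2 by nlinarith) (sub_nonneg.2 h2)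
  have k3 := mul_nonneg (sq_nonneg q) (sub_nonneg.2 h3)
  have k4 := mul_nonneg hpq (sub_nonneg.2 h4)
  have k5 := mul_nonneg hpq (sub_nonneg.2 hl)
  -- Arithmetic-geometric mean inequality for `q √b` and `p √e`.
  have k6 : p * q * (2 * √(b * e)) ≤ q ^ 2 * b + p ^ 2 * e := by
    have hs : √(b * e) = √b * √e := Real.sqrt_mul hb e
    have hb' := Real.sq_sqrt hb
    have he' := Real.sq_sqrt he
    rw [hs]
    nlinarith [sq_nonneg (q * √b - p * √e)]
  nlinarith

lemma re_inner_sum_smul (T : H →L[ℂ] H) (w : Fin 4 → H) (x y : Fin 4 → ℝ) :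
    (inner ℂ (∑ i, (x i : ℂ) • w i) (T (∑ j, (y j : ℂ) • w j))).re =
      ∑ i, ∑ j, x i * y j * (inner ℂ (w i) (T (w j))).re := by
  simp only [map_sum, map_smul, sum_inner, inner_sum, inner_smul_left, inner_smul_right,
    Complex.re_sum, Complex.conj_ofReal, Complex.re_ofReal_mul, Finset.mul_sum]
  rw [Finset.sum_comm]
  exact Finset.sum_congr rfl fun i _ => Finset.sum_congr rfl fun j _ => by ring

lemma inner_sum_smul_of_orthonormal {w : Fin 4 → H} (hw : Orthonormal ℂ w) (x y : Fin 4 → ℝ) :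
    inner ℂ (∑ i, (x i : ℂ) • w i) (∑ j, (y j : ℂ) • w j) = ((∑ i, x i * y i : ℝ) : ℂ) := by
  rw [hw.inner_sum]
  simp

/-- The product rows `a_j ⊗ f_k` of two rotations, in the order `00, 11, 01, 10`, written in the
frame whose second half is reflected by `(γ, σ)`. -/
def productRows (ct st cf sf γ σ : ℝ) : Matrix (Fin 4) (Fin 4) ℝ :=
  !![ct * cf, ct * sf, st * (cf * γ + sf * σ), st * (cf * σ - sf * γ);
    st * sf, -(st * cf), ct * (-sf * γ + cf * σ), ct * (-sf * σ - cf * γ);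
    ct * (-sf), ct * cf, st * (-sf * γ + cf * σ), st * (-sf * σ - cf * γ);
    -st * cf, -st * sf, ct * (cf * γ + sf * σ), ct * (cf * σ - sf * γ)]

lemma productRows_mul_transpose {ct st cf sf γ σ : ℝ} (hθ : ct ^ 2 + st ^ 2 = 1)
    (hφ : cf ^ 2 + sf ^ 2 = 1) (hγσ : γ ^ 2 + σ ^ 2 = 1) :
    productRows ct st cf sf γ σ * (productRows ct st cf sf γ σ)ᵀ = 1 := by
  ext i j
  simp only [Matrix.mul_apply, Fin.sum_univ_four, Matrix.transpose_apply]
  fin_cases i <;> fin_cases j <;> simp [productRows] <;> grind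

/-- The rotation by `±45°` in the last two coordinates. -/
def lastRotation (r ε : ℝ) : Matrix (Fin 4) (Fin 4) ℝ :=
  !![1, 0, 0, 0; 0, 1, 0, 0; 0, 0, r, r * ε; 0, 0, r, -(r * ε)]

lemma lastRotation_mul_transpose {r ε : ℝ} (hr : r ^ 2 = 2⁻¹) (hε : ε ^ 2 = 1) :
    lastRotation r ε * (lastRotation r ε)ᵀ = 1 := by
  ext i j
  simp only [Matrix.mul_apply, Fin.sum_univ_four, Matrix.transpose_apply]
  fin_cases i <;> fin_cases j <;> simp [lastRotation] <;> grind

/-- The partial transpose of the projector onto a vector with Schmidt coefficients `p`, `q` has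
eigenvalues `p²`, `q²`, `±pq`. Its cross term is diagonalised by the 45° rotation, and `ε` absorbs
the sign of `q`, so that the diagonal form meets the sign condition of
`SpectralBounds.weighted_sum_nonneg`. -/
lemma quadratic_form_lastRotation (z s : Matrix (Fin 4) (Fin 4) ℝ) {p q r ε : ℝ}
    (hr : r ^ 2 = 2⁻¹) (hε : ε ^ 2 = 1) :
    let y := lastRotation r ε * z
    p ^ 2 * (∑ i, ∑ j, y 0 i * y 0 j * s i j) +
        (q * ε) ^ 2 * (∑ i, ∑ j, y 1 i * y 1 j * s i j) + p * (q * ε) *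
        ((∑ i, ∑ j, y 2 i * y 2 j * s i j) - ∑ i, ∑ j, y 3 i * y 3 j * s i j) =
      p ^ 2 * (∑ i, ∑ j, z 0 i * z 0 j * s i j) + q ^ 2 * (∑ i, ∑ j, z 1 i * z 1 j * s i j) +
        p * q * ((∑ i, ∑ j, z 2 i * z 3 j * s i j) + ∑ i, ∑ j, z 3 i * z 2 j * s i j) := by
  intro y
  have y0 : ∀ k, y 0 k = z 0 k := fun k => Matrix.mul_apply.trans <| by
    rw [Fin.sum_univ_four]; simp [lastRotation]
  have y1 : ∀ k, y 1 k = z 1 k := fun k => Matrix.mul_apply.trans <| by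
    rw [Fin.sum_univ_four]; simp [lastRotation]
  have y2 : ∀ k, y 2 k = r * z 2 k + r * ε * z 3 k := fun k => Matrix.mul_apply.trans <| by
    rw [Fin.sum_univ_four]; simp [lastRotation]
  have y3 : ∀ k, y 3 k = r * z 2 k - r * ε * z 3 k := fun k => Matrix.mul_apply.trans <| by
    rw [Fin.sum_univ_four]; simp [lastRotation, sub_eq_add_neg]
  have e3 : (∑ i, ∑ j, y 2 i * y 2 j * s i j) - ∑ i, ∑ j, y 3 i * y 3 j * s i j =
      ε * ((∑ i, ∑ j, z 2 i * z 3 j * s i j) + ∑ i, ∑ j, z 3 i * z 2 j * s i j) := by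
    simp only [← Finset.sum_sub_distrib, ← Finset.sum_add_distrib, Finset.mul_sum]
    refine Finset.sum_congr rfl fun i _ => Finset.sum_congr rfl fun j _ => ?_
    rw [y2, y2, y3, y3]
    linear_combination (2 * ε * s i j * (z 2 i * z 3 j + z 3 i * z 2 j)) * hr
  rw [e3]
  simp only [y0, y1]
  linear_combination (q ^ 2 * (∑ i, ∑ j, z 1 i * z 1 j * s i j) + p * q *
    ((∑ i, ∑ j, z 2 i * z 3 j * s i j) + ∑ i, ∑ j, z 3 i * z 2 j * s i j)) * hε

/-- The left side depends on the decomposition only through the matrix `m`: it is the partially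
transposed form evaluated at `m`. Hence the coefficient of `m₀₀ * m₁₁` couples `w 1` to the first
reflected vector, where the untransposed form would couple `w 0` to the second. -/
lemma quadratic_form_productRows (s : Matrix (Fin 4) (Fin 4) ℝ) (hs : ∀ i j, s i j = s j i)
    {p q ct st cf sf γ σ m₀₀ m₀₁ m₁₀ m₁₁ : ℝ}
    (h00 : m₀₀ = p * (ct * cf) + q * (st * sf)) (h01 : m₀₁ = p * (ct * sf) - q * (st * cf))
    (h10 : m₁₀ = p * (st * cf) - q * (ct * sf)) (h11 : m₁₁ = p * (st * sf) + q * (ct * cf)) :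
    let z := productRows ct st cf sf γ σ
    p ^ 2 * (∑ i, ∑ j, z 0 i * z 0 j * s i j) + q ^ 2 * (∑ i, ∑ j, z 1 i * z 1 j * s i j) +
        p * q * ((∑ i, ∑ j, z 2 i * z 3 j * s i j) + ∑ i, ∑ j, z 3 i * z 2 j * s i j) =
      m₀₀ ^ 2 * s 0 0 + 2 * m₀₀ * m₀₁ * s 0 1 + m₀₁ ^ 2 * s 1 1 +
        2 * (m₀₀ * m₁₀ * (γ * s 0 2 + σ * s 0 3) + m₀₀ * m₁₁ * (γ * s 1 2 + σ * s 1 3)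
          + m₀₁ * m₁₀ * (σ * s 0 2 - γ * s 0 3) + m₀₁ * m₁₁ * (σ * s 1 2 - γ * s 1 3)) +
        (m₁₀ * γ + m₁₁ * σ) ^ 2 * s 2 2 + (m₁₀ * σ - m₁₁ * γ) ^ 2 * s 3 3 +
        2 * (m₁₀ * γ + m₁₁ * σ) * (m₁₀ * σ - m₁₁ * γ) * s 2 3 := by
  intro z
  subst h00 h01 h10 h11
  simp only [Fin.sum_univ_four, hs 1 0, hs 2 0, hs 3 0, hs 2 1, hs 3 1, hs 3 2]
  simp [z, productRows]
  ring

/-- The quadratic form of the positive partial transpose criterion, in a pair of isometric frames. -/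
lemma SpectralBounds.two_mul_re_inner_le {T : H →L[ℂ] H} {l b c e : ℝ}
    (hT : SpectralBounds T l b c e) (hb : 0 ≤ b) (he : 0 ≤ e) (hl : l ≤ c + 2 * √(b * e))
    (w : Fin 4 → H) (hw : Orthonormal ℂ w) (γ σ τ : ℝ) (hγσ : γ ^ 2 + σ ^ 2 = 1) (hτ : 0 < τ) :
    2 * (inner ℂ ((γ : ℂ) • w 0 + (σ : ℂ) • w 1) (T ((γ : ℂ) • w 2 + (σ : ℂ) • w 3))).re ≤
      τ ^ 2 * (inner ℂ (w 0) (T (w 0))).re + (τ⁻¹) ^ 2 * (inner ℂ (w 2) (T (w 2))).re := by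
  -- The second row is chosen so that, after the reflection by `(γ, σ)`, it becomes `-τ⁻¹` times the
  -- first unit vector: only the two diagonal terms and the wanted cross term survive.
  obtain ⟨p, q, θ, φ, hqp, h00, h01, h10, h11⟩ :=
    exists_rotation_svd τ 0 (-(τ⁻¹ * γ)) (-(τ⁻¹ * σ))
  set s : Matrix (Fin 4) (Fin 4) ℝ := fun i j => (inner ℂ (w i) (T (w j))).re with hs
  have hsymm : ∀ i j, s i j = s j i := fun i j => by
    simp only [hs]
    rw [hT.isSymmetric, ← inner_conj_symm, Complex.conj_re]
  obtain ⟨ε, hε, hqε⟩ : ∃ ε : ℝ, ε ^ 2 = 1 ∧ 0 ≤ q * ε := by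
    rcases le_total 0 q with h | h
    · exact ⟨1, by norm_num, by linarith⟩
    · exact ⟨-1, by norm_num, by linarith⟩
  have hr : √(2⁻¹ : ℝ) ^ 2 = 2⁻¹ := Real.sq_sqrt (by norm_num)
  set z := productRows (Real.cos θ) (Real.sin θ) (Real.cos φ) (Real.sin φ) γ σ with hz
  set y := lastRotation √2⁻¹ ε * z with hy
  have hyy : y * yᵀ = 1 := by
    rw [hy, Matrix.transpose_mul, Matrix.mul_assoc, ← Matrix.mul_assoc z,
      productRows_mul_transpose (Real.cos_sq_add_sin_sq θ) (Real.cos_sq_add_sin_sq φ) hγσ,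
      Matrix.one_mul, lastRotation_mul_transpose hr hε]
  let g : Fin 4 → H := fun i => ∑ k, (y i k : ℂ) • w k
  have hg : Orthonormal ℂ g := by
    rw [orthonormal_iff_ite]
    intro i j
    have := congrFun (congrFun hyy i) j
    rw [Matrix.mul_apply, Matrix.one_apply] at this
    simp only [Matrix.transpose_apply] at this
    simp only [g]
    rw [inner_sum_smul_of_orthonormal hw, this]
    split_ifs <;> simp
  have habs : q * ε ≤ p := (le_abs_self _).trans (by
    rw [abs_mul, show |ε| = 1 by rwa [← sq_eq_sq₀ (abs_nonneg _) zero_le_one, sq_abs, one_pow],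
      mul_one]; exact hqp)
  have main := hT.weighted_sum_nonneg hb he hl (p := p) hqε habs g hg
  simp only [g, re_inner_sum_smul] at main
  have main' := main.trans_eq ((quadratic_form_lastRotation z s hr hε).trans
    (quadratic_form_productRows s hsymm h00 h01 h10 h11))
  have e1 : (inner ℂ ((γ : ℂ) • w 0 + (σ : ℂ) • w 1)
      (T ((γ : ℂ) • w 2 + (σ : ℂ) • w 3))).re =
        γ * γ * s 0 2 + γ * σ * s 0 3 + σ * γ * s 1 2 + σ * σ * s 1 3 := by
    simp only [hs, map_add, map_smul, inner_add_left, inner_add_right, inner_smul_left,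
      inner_smul_right, Complex.add_re, Complex.conj_ofReal, Complex.re_ofReal_mul]
    ring
  rw [e1]
  refine sub_nonneg.1 (main'.trans_eq ?_)
  have hττ : τ * τ⁻¹ = 1 := mul_inv_cancel₀ hτ.ne'
  have e5 : -(τ⁻¹ * γ) * γ + -(τ⁻¹ * σ) * σ = -τ⁻¹ := by linear_combination (-τ⁻¹) * hγσ
  rw [e5]
  linear_combination (-2 * (γ * γ * s 0 2 + γ * σ * s 0 3 + σ * γ * s 1 2 + σ * σ * s 1 3)) * hττ

/-- A unit vector `x` in the orthonormal frame that starts with a multiple of `v`. -/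
lemma exists_frame_of_unit {E : Type*} [NormedAddCommGroup E] [InnerProductSpace ℂ E]
    (hE : 1 < Module.finrank ℂ E) {x v : E} (hx : ‖x‖ = 1) (hv : ‖v‖ = 1) :
    ∃ (ω : ℂ) (v' : E), ‖ω‖ = 1 ∧ ‖v'‖ = 1 ∧ inner ℂ v v' = 0 ∧
      x = ((‖inner ℂ v x‖ : ℝ) : ℂ) • (ω • v) + ((√(1 - ‖inner ℂ v x‖ ^ 2) : ℝ) : ℂ) • v' := by
  set r := x - (inner ℂ v x : ℂ) • v with hr
  have hvv : inner ℂ v v = 1 := by rw [inner_self_eq_norm_sq_to_K, hv]; simp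
  have hvr : inner ℂ v r = 0 := by rw [hr, inner_sub_right, inner_smul_right, hvv]; simp
  have hnorm : ‖r‖ ^ 2 = 1 - ‖inner ℂ v x‖ ^ 2 := by
    have h1 : x = (inner ℂ v x : ℂ) • v + r := by rw [hr]; abel
    have h2 := norm_add_sq_eq_norm_sq_add_norm_sq_of_inner_eq_zero (𝕜 := ℂ)
      ((inner ℂ v x : ℂ) • v) r (by rw [inner_smul_left, hvr, mul_zero])
    rw [← h1, hx, norm_smul, hv] at h2
    nlinarith
  have hr0 : √(1 - ‖inner ℂ v x‖ ^ 2) = ‖r‖ := by rw [← hnorm, Real.sqrt_sq (norm_nonneg _)]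
  obtain ⟨v', hv', hvv', hrv'⟩ : ∃ v' : E, ‖v'‖ = 1 ∧ inner ℂ v v' = 0 ∧ r = (‖r‖ : ℂ) • v' := by
    -- If `x` is a multiple of `v`, any unit vector orthogonal to `v` serves; the dimension
    -- hypothesis provides one.
    by_cases h : r = 0
    · obtain ⟨y, hy⟩ : ∃ y : E, y ∉ Submodule.span ℂ {v} := by
        by_contra! hcon
        have htop : Submodule.span ℂ {v} = ⊤ := eq_top_iff.2 fun y _ => hcon y
        have := finrank_span_singleton (K := ℂ) (v := v) (by rintro rfl; simp at hv)
        rw [htop, finrank_top] at this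
        omega
      have hne : y - (inner ℂ v y : ℂ) • v ≠ 0 := fun h0 => hy (by
        rw [sub_eq_zero.1 h0]
        exact Submodule.smul_mem _ _ (Submodule.mem_span_singleton_self v))
      refine ⟨((‖y - (inner ℂ v y : ℂ) • v‖⁻¹ : ℝ) : ℂ) • (y - (inner ℂ v y : ℂ) • v), ?_, ?_, ?_⟩
      · rw [norm_smul, Complex.norm_real, norm_inv, norm_norm,
          inv_mul_cancel₀ (norm_ne_zero_iff.2 hne)]
      · rw [inner_smul_right, inner_sub_right, inner_smul_right, hvv]; simp
      · simp [h]
    · refine ⟨((‖r‖⁻¹ : ℝ) : ℂ) • r, ?_, ?_, ?_⟩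
      · rw [norm_smul, Complex.norm_real, norm_inv, norm_norm,
          inv_mul_cancel₀ (norm_ne_zero_iff.2 h)]
      · rw [inner_smul_right, hvr, mul_zero]
      · rw [smul_smul, ← Complex.ofReal_mul, mul_inv_cancel₀ (norm_ne_zero_iff.2 h)]; simp
  obtain ⟨ω, hω, hωv⟩ : ∃ ω : ℂ, ‖ω‖ = 1 ∧ inner ℂ v x = ((‖inner ℂ v x‖ : ℝ) : ℂ) * ω := by
    by_cases h : inner ℂ v x = 0
    · exact ⟨1, by simp, by simp [h]⟩
    · have h' : (‖inner ℂ v x‖ : ℂ) ≠ 0 := by simpa using h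
      refine ⟨inner ℂ v x / ‖inner ℂ v x‖, ?_, ?_⟩
      · rw [norm_div, Complex.norm_real, norm_norm, div_self (by simpa using h)]
      · field_simp
  refine ⟨ω, v', hω, hv', hvv', ?_⟩
  rw [hr0, smul_smul, ← hωv, ← hrv', hr]
  abel

/-- The absolute positive partial transpose inequality `|⟨X, T Y⟩|² ≤ ⟨V, T V⟩ ⟨W, T W⟩` for
vectors from two orthogonal frames with matching angles. -/
lemma SpectralBounds.re_inner_le_sqrt {E : Type*} [NormedAddCommGroup E] [InnerProductSpace ℂ E]
    (hE : 1 < Module.finrank ℂ E) {T : H →L[ℂ] H} {l b c e : ℝ}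
    (hT : SpectralBounds T l b c e) (hb : 0 ≤ b) (he : 0 < e) (hl : l ≤ c + 2 * √(b * e))
    {Φ Ψ : E →L[ℂ] H} (hΦ : ∀ x y, inner ℂ (Φ x) (Φ y) = inner ℂ x y)
    (hΨ : ∀ x y, inner ℂ (Ψ x) (Ψ y) = inner ℂ x y) (hΦΨ : ∀ x y, inner ℂ (Φ x) (Ψ y) = 0)
    {x y v w : E} (hx : ‖x‖ = 1) (hy : ‖y‖ = 1) (hv : ‖v‖ = 1) (hw : ‖w‖ = 1)
    (h : ‖inner ℂ v x‖ = ‖inner ℂ w y‖) :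
    (inner ℂ (Φ x) (T (Ψ y))).re ≤
      √((inner ℂ (Φ v) (T (Φ v))).re * (inner ℂ (Ψ w) (T (Ψ w))).re) := by
  obtain ⟨ω₁, v', hω₁, hv', hvv', hxv⟩ := exists_frame_of_unit hE hx hv
  obtain ⟨ω₂, w', hω₂, hw', hww', hyw⟩ := exists_frame_of_unit hE hy hw
  have hΦn : ∀ x, ‖Φ x‖ = ‖x‖ := fun x => by
    rw [@norm_eq_sqrt_re_inner ℂ, hΦ, ← @norm_eq_sqrt_re_inner ℂ]
  have hΨn : ∀ x, ‖Ψ x‖ = ‖x‖ := fun x => by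
    rw [@norm_eq_sqrt_re_inner ℂ, hΨ, ← @norm_eq_sqrt_re_inner ℂ]
  have hΨΦ : ∀ x y, inner ℂ (Ψ x) (Φ y) = 0 := fun x y => by
    rw [← inner_conj_symm, hΦΨ, map_zero]
  have hv'v : inner ℂ v' v = 0 := by rw [← inner_conj_symm, hvv', map_zero]
  have hw'w : inner ℂ w' w = 0 := by rw [← inner_conj_symm, hww', map_zero]
  have hquad : ∀ (ω : ℂ) (u : H), ‖ω‖ = 1 →
      (inner ℂ (ω • u) (T (ω • u))).re = (inner ℂ u (T u)).re := fun ω u hω => by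
    rw [map_smul, inner_smul_left, inner_smul_right, ← mul_assoc, Complex.conj_mul', hω]
    simp
  set γ := ‖inner ℂ v x‖
  set σ := √(1 - γ ^ 2)
  have hγ : γ ^ 2 ≤ 1 := by
    have := norm_inner_le_norm (𝕜 := ℂ) v x
    rw [hv, hx, one_mul] at this
    exact pow_le_one₀ (norm_nonneg _) this
  have hγσ : γ ^ 2 + σ ^ 2 = 1 := by rw [Real.sq_sqrt (by linarith)]; ring
  let u : Fin 4 → H := ![Φ (ω₁ • v), Φ v', Ψ (ω₂ • w), Ψ w']
  have hu : Orthonormal ℂ u := by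
    refine ⟨fun i => ?_, fun i j hij => ?_⟩
    · fin_cases i <;> simp [u, hΦn, hΨn, hω₁, hω₂, hv, hv', hw, hw', norm_smul]
    · fin_cases i <;> fin_cases j <;>
        first
        | exact absurd rfl hij
        | simp [u, hΦ, hΨ, hΦΨ, hΨΦ, hvv', hww', hv'v, hw'w, inner_smul_left, inner_smul_right]
  set A := (inner ℂ (Φ v) (T (Φ v))).re with hA
  set C := (inner ℂ (Ψ w) (T (Ψ w))).re with hC
  have hA0 : 0 < A := he.trans_le (hT.le_one _ (by rw [hΦn, hv]))
  have hC0 : 0 < C := he.trans_le (hT.le_one _ (by rw [hΨn, hw]))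
  have hsA : √A ^ 2 = A := Real.sq_sqrt hA0.le
  have hsC : √C ^ 2 = C := Real.sq_sqrt hC0.le
  have hsA0 := Real.sqrt_pos.2 hA0
  have hsC0 := Real.sqrt_pos.2 hC0
  -- This `τ` minimises `τ² A + τ⁻² C`, with minimum `2 √(A C)`. The equality of overlaps lets the
  -- same `γ`, `σ` describe both `x` and `y`.
  have key := hT.two_mul_re_inner_le hb he.le hl u hu γ σ √(√C / √A) hγσ
    (Real.sqrt_pos.2 (by positivity))
  have hX : (γ : ℂ) • u 0 + (σ : ℂ) • u 1 = Φ x := by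
    conv_rhs => rw [hxv]
    simp [u]
  have hY : (γ : ℂ) • u 2 + (σ : ℂ) • u 3 = Ψ y := by
    conv_rhs => rw [hyw, ← h]
    simp [u, σ]
  rw [hX, hY, inv_pow, Real.sq_sqrt (by positivity)] at key
  have h0 : (inner ℂ (u 0) (T (u 0))).re = A := by
    simp only [u, Matrix.cons_val]
    rw [map_smul, hquad _ _ hω₁]
  have h2 : (inner ℂ (u 2) (T (u 2))).re = C := by
    simp only [u, Matrix.cons_val]
    rw [map_smul, hquad _ _ hω₂]
  rw [h0, h2] at key
  rw [Real.sqrt_mul hA0.le]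
  have e1 : √C / √A * A = √A * √C := by
    field_simp; rw [hsA]
  have e2 : (√C / √A)⁻¹ * C = √A * √C := by
    field_simp; rw [hsC]
  rw [e1, e2] at key
  linarith

end SpectralBounds

/-! ### An intermediate value theorem over an interval. -/

/-- A continuous function that takes values of both signs on a compact set fibred over an interval,
with connected fibres, vanishes somewhere on it. -/
lemma exists_eq_zero_of_isPreconnected_fibers {Y : Type*} [TopologicalSpace Y] [T2Space Y]
    {K : Set (ℝ × Y)} (hK : IsCompact K) {α β : ℝ} (hKI : ∀ p ∈ K, p.1 ∈ Set.Icc α β)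
    (hne : ∀ s ∈ Set.Icc α β, ∃ y, (s, y) ∈ K)
    (hconn : ∀ s ∈ Set.Icc α β, IsPreconnected {y | (s, y) ∈ K})
    {f : ℝ × Y → ℝ} (hf : Continuous f) (hpos : ∃ p ∈ K, 0 ≤ f p) (hneg : ∃ p ∈ K, f p ≤ 0) :
    ∃ p ∈ K, f p = 0 := by
  have hc1 : IsClosed (Prod.fst '' (K ∩ {p | 0 ≤ f p})) :=
    ((hK.inter_right (isClosed_le continuous_const hf)).image continuous_fst).isClosed
  have hc2 : IsClosed (Prod.fst '' (K ∩ {p | f p ≤ 0})) :=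
    ((hK.inter_right (isClosed_le hf continuous_const)).image continuous_fst).isClosed
  obtain ⟨p, hp, hp0⟩ := hpos
  obtain ⟨q, hq, hq0⟩ := hneg
  -- The projections of `{0 ≤ f}` and `{f ≤ 0}` are closed and cover the interval, so they meet;
  -- over a common point the connected fibre carries both signs.
  obtain ⟨s, hs, ⟨⟨s₁, y₁⟩, ⟨h1, h1'⟩, rfl⟩, ⟨⟨s₂, y₂⟩, ⟨h2, h2'⟩, h⟩⟩ :=
    isPreconnected_closed_iff.1 (isPreconnected_Icc (a := α) (b := β)) _ _ hc1 hc2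
      (fun s hs => by
        obtain ⟨y, hy⟩ := hne s hs
        rcases le_total 0 (f (s, y)) with h | h
        · exact Or.inl ⟨_, ⟨hy, h⟩, rfl⟩
        · exact Or.inr ⟨_, ⟨hy, h⟩, rfl⟩)
      ⟨p.1, hKI p hp, p, ⟨hp, hp0⟩, rfl⟩ ⟨q.1, hKI q hq, q, ⟨hq, hq0⟩, rfl⟩
  dsimp only at h hs
  subst h
  obtain ⟨y, hy, hy0⟩ := (hconn _ hs).intermediate_value h2 h1
    (f := fun y => f (s₂, y)) (by fun_prop) ⟨h2', h1'⟩
  exact ⟨_, hy, hy0⟩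

/-! ### Top eigenvectors and singular vectors. -/

section TopEigenvectors

variable {E : Type*} [NormedAddCommGroup E] [InnerProductSpace ℂ E] [FiniteDimensional ℂ E]

/-- The unit vectors of a complex subspace form a connected set. -/
lemma isPreconnected_unit_vectors (F : Submodule ℂ E) :
    IsPreconnected {v : E | ‖v‖ = 1 ∧ v ∈ F} := by
  have himg : {v : E | ‖v‖ = 1 ∧ v ∈ F} = Subtype.val '' (Metric.sphere (0 : F) 1) := by
    ext v
    simp only [Set.mem_ofPred_eq, Set.mem_image, mem_sphere_zero_iff_norm]
    constructor
    · rintro ⟨h1, h2⟩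
      exact ⟨⟨v, h2⟩, h1, rfl⟩
    · rintro ⟨x, hx, rfl⟩
      exact ⟨hx, x.2⟩
  rw [himg]
  refine IsPreconnected.image ?_ _ continuous_subtype_val.continuousOn
  rcases subsingleton_or_nontrivial F with h | h
  · exact Set.Subsingleton.isPreconnected (Set.subsingleton_of_subsingleton)
  -- A nonzero complex subspace has real dimension at least two, so its unit sphere is connected.
  · apply isPreconnected_sphere
    apply Module.lt_rank_of_lt_finrank
    have h1 : 0 < Module.finrank ℂ F := Module.finrank_pos
    have h2 := finrank_real_of_complex F
    omega

/-- The unit eigenvectors of `P` with eigenvalue `‖P‖`. -/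
def topEigenvectors (P : E →L[ℂ] E) : Set E := {v | ‖v‖ = 1 ∧ P v = (‖P‖ : ℂ) • v}

lemma isPreconnected_topEigenvectors (P : E →L[ℂ] E) : IsPreconnected (topEigenvectors P) := by
  convert isPreconnected_unit_vectors (Module.End.eigenspace (P : E →ₗ[ℂ] E) (‖P‖ : ℂ)) using 1
  ext v
  simp [topEigenvectors]

/-- The norm of a positive operator belongs to its spectrum, and in finite dimension the spectrum
consists of eigenvalues. -/
lemma topEigenvectors_nonempty [Nontrivial E] {P : E →L[ℂ] E} (hP : P.IsPositive) :
    (topEigenvectors P).Nonempty := by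
  have : CompleteSpace E := FiniteDimensional.complete ℂ E
  have h1 : ‖P‖ ∈ spectrum ℝ P := CStarAlgebra.norm_mem_spectrum_of_nonneg
    (by rwa [ContinuousLinearMap.nonneg_iff_isPositive])
  have h2 : (‖P‖ : ℂ) ∈ spectrum ℂ P := by
    have := spectrum.algebraMap_mem_iff (R := ℝ) ℂ (a := P) (r := ‖P‖)
    simpa using this.2 h1
  have h3 : Module.End.HasEigenvalue (P : E →ₗ[ℂ] E) (‖P‖ : ℂ) := by
    rwa [Module.End.hasEigenvalue_iff_mem_spectrum,
      ← ContinuousLinearMap.spectrum_eq]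
  obtain ⟨v, hv⟩ := h3.exists_hasEigenvector
  have hv0 : ‖v‖ ≠ 0 := norm_ne_zero_iff.2 hv.2
  refine ⟨((‖v‖⁻¹ : ℝ) : ℂ) • v, ?_, ?_⟩
  · rw [norm_smul, Complex.norm_real, norm_inv, norm_norm, inv_mul_cancel₀ hv0]
  · rw [map_smul, smul_comm]
    congr 1
    exact hv.apply_eq_smul

omit [FiniteDimensional ℂ E] in
lemma isClosed_topEigenvectors_graph {X : Type*} [TopologicalSpace X] {P : X → E →L[ℂ] E}
    (hP : Continuous P) : IsClosed {p : X × E | p.2 ∈ topEigenvectors (P p.1)} := by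
  refine IsClosed.inter (isClosed_eq (by fun_prop) (by fun_prop)) (isClosed_eq ?_ ?_)
  · exact (hP.comp continuous_fst).clm_apply continuous_snd
  · exact (Complex.continuous_ofReal.comp (hP.comp continuous_fst).norm).smul continuous_snd

omit [FiniteDimensional ℂ E] in
lemma norm_self_comp_adjoint [CompleteSpace E] (B : E →L[ℂ] E) :
    ‖B ∘L ContinuousLinearMap.adjoint B‖ = ‖B‖ ^ 2 := by
  have := ContinuousLinearMap.norm_adjoint_comp_self (ContinuousLinearMap.adjoint B)
  rw [ContinuousLinearMap.adjoint_adjoint, LinearIsometryEquiv.norm_map] at this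
  rw [this, sq]

omit [FiniteDimensional ℂ E] in
/-- A top left singular vector `x` of `B` has a partner, a top right singular vector. -/
lemma exists_singular_partner [CompleteSpace E] {B : E →L[ℂ] E} (hB : B ≠ 0) {x : E}
    (hx : x ∈ topEigenvectors (B ∘L ContinuousLinearMap.adjoint B)) :
    ∃ y ∈ topEigenvectors (ContinuousLinearMap.adjoint B ∘L B), B y = (‖B‖ : ℂ) • x ∧
      ContinuousLinearMap.adjoint B x = (‖B‖ : ℂ) • y := by
  have hn : (‖B‖ : ℂ) ≠ 0 := by simpa using hB
  have hnr : ‖B‖ ≠ 0 := by simpa using hB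
  obtain ⟨hx1, hx2⟩ := hx
  rw [norm_self_comp_adjoint, ContinuousLinearMap.comp_apply] at hx2
  have hy : ContinuousLinearMap.adjoint B x = (‖B‖ : ℂ) • ((‖B‖ : ℂ)⁻¹ •
      ContinuousLinearMap.adjoint B x) := by rw [smul_smul, mul_inv_cancel₀ hn, one_smul]
  have hBy : B ((‖B‖ : ℂ)⁻¹ • ContinuousLinearMap.adjoint B x) = (‖B‖ : ℂ) • x := by
    rw [map_smul, hx2, smul_smul]
    congr 1
    push_cast
    field_simp
  have hBx : ‖ContinuousLinearMap.adjoint B x‖ ^ 2 = ‖B‖ ^ 2 := by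
    have h1 : (inner ℂ x (B (ContinuousLinearMap.adjoint B x)) : ℂ) =
        ((‖ContinuousLinearMap.adjoint B x‖ ^ 2 : ℝ) : ℂ) := by
      rw [← ContinuousLinearMap.adjoint_inner_left, inner_self_eq_norm_sq_to_K]
      simp
    rw [hx2, inner_smul_right, inner_self_eq_norm_sq_to_K, hx1] at h1
    simp only [map_one, one_pow, mul_one] at h1
    exact_mod_cast h1.symm
  have hBx' : ‖ContinuousLinearMap.adjoint B x‖ = ‖B‖ :=
    (sq_eq_sq₀ (norm_nonneg _) (norm_nonneg _)).1 hBx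
  refine ⟨(‖B‖ : ℂ)⁻¹ • ContinuousLinearMap.adjoint B x, ⟨?_, ?_⟩, hBy, hy⟩
  · rw [norm_smul, norm_inv, Complex.norm_real, norm_norm, hBx', inv_mul_cancel₀ hnr]
  · rw [ContinuousLinearMap.comp_apply, hBy, map_smul, ContinuousLinearMap.norm_adjoint_comp_self]
    conv_lhs => rw [hy]
    rw [smul_smul]
    push_cast
    rfl

end TopEigenvectors

/-! ### Rotating the qubit basis until the overlaps match. -/

section RotatedFrames

variable {E H : Type*} [NormedAddCommGroup E] [InnerProductSpace ℂ E] [FiniteDimensional ℂ E]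
  [NormedAddCommGroup H] [InnerProductSpace ℂ H] [FiniteDimensional ℂ H]

/-- The embedding `x ↦ (cos s e₀ + sin s e₁) ⊗ x`, where `ι₀ x = e₀ ⊗ x` and `ι₁ x = e₁ ⊗ x`. -/
noncomputable def rotatedEmbedding (ι₀ ι₁ : E →L[ℂ] H) (s : ℝ) : E →L[ℂ] H :=
  (Real.cos s : ℂ) • ι₀ + (Real.sin s : ℂ) • ι₁

omit [FiniteDimensional ℂ E] [FiniteDimensional ℂ H] in
lemma continuous_rotatedEmbedding (ι₀ ι₁ : E →L[ℂ] H) :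
    Continuous (rotatedEmbedding ι₀ ι₁) := by
  unfold rotatedEmbedding
  fun_prop

omit [FiniteDimensional ℂ E] [FiniteDimensional ℂ H] in
-- Equal angles give an isometry, and angles a quarter turn apart give orthogonal ranges.
lemma inner_rotatedEmbedding {ι₀ ι₁ : E →L[ℂ] H} (h₀ : ∀ x y, inner ℂ (ι₀ x) (ι₀ y) = inner ℂ x y)
    (h₁ : ∀ x y, inner ℂ (ι₁ x) (ι₁ y) = inner ℂ x y) (h₀₁ : ∀ x y, inner ℂ (ι₀ x) (ι₁ y) = 0)
    (s t : ℝ) (x y : E) :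
    inner ℂ (rotatedEmbedding ι₀ ι₁ s x) (rotatedEmbedding ι₀ ι₁ t y) =
      (Real.cos (s - t) : ℂ) * inner ℂ x y := by
  have h₁₀ : ∀ x y, inner ℂ (ι₁ x) (ι₀ y) = 0 := fun x y => by
    rw [← inner_conj_symm, h₀₁, map_zero]
  simp only [rotatedEmbedding, add_apply, smul_apply,
    inner_add_left, inner_add_right, inner_smul_left, inner_smul_right, h₀, h₁, h₀₁, h₁₀,
    Complex.conj_ofReal, Real.cos_sub]
  push_cast
  ring

/-- In a suitable real rotation of the two frames, the off-diagonal block of `T` is dominated by the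
smallest eigenvalues of the diagonal blocks. -/
theorem SpectralBounds.exists_rotation (hE : 1 < Module.finrank ℂ E) {T : H →L[ℂ] H}
    {l b c e : ℝ} (hT : SpectralBounds T l b c e) (hb : 0 ≤ b) (he : 0 < e)
    (hl : l ≤ c + 2 * √(b * e)) {ι₀ ι₁ : E →L[ℂ] H}
    (h₀ : ∀ x y, inner ℂ (ι₀ x) (ι₀ y) = inner ℂ x y)
    (h₁ : ∀ x y, inner ℂ (ι₁ x) (ι₁ y) = inner ℂ x y) (h₀₁ : ∀ x y, inner ℂ (ι₀ x) (ι₁ y) = 0) :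
    ∃ s α β : ℝ, 0 < α ∧ 0 < β ∧
      (∀ x, α * ‖x‖ ^ 2 ≤
        (inner ℂ (rotatedEmbedding ι₀ ι₁ s x) (T (rotatedEmbedding ι₀ ι₁ s x))).re) ∧
      (∀ x, β * ‖x‖ ^ 2 ≤ (inner ℂ (rotatedEmbedding ι₀ ι₁ (s + Real.pi / 2) x)
        (T (rotatedEmbedding ι₀ ι₁ (s + Real.pi / 2) x))).re) ∧
      ∀ x y, ‖inner ℂ (rotatedEmbedding ι₀ ι₁ s x)
        (T (rotatedEmbedding ι₀ ι₁ (s + Real.pi / 2) y))‖ ≤ √(α * β) * (‖x‖ * ‖y‖) := by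
  have : CompleteSpace E := FiniteDimensional.complete ℂ E
  have : CompleteSpace H := FiniteDimensional.complete ℂ H
  have : Nontrivial E := Module.nontrivial_of_finrank_pos (R := ℂ) (by omega)
  set R := rotatedEmbedding ι₀ ι₁ with hR
  have hRc : Continuous R := continuous_rotatedEmbedding ι₀ ι₁
  have hRi : ∀ s x y, inner ℂ (R s x) (R s y) = inner ℂ x y := fun s x y => by
    rw [hR, inner_rotatedEmbedding h₀ h₁ h₀₁]; simp
  have hRn : ∀ s x, ‖R s x‖ = ‖x‖ := fun s x => by
    rw [@norm_eq_sqrt_re_inner ℂ, hRi, ← @norm_eq_sqrt_re_inner ℂ]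
  have hRo : ∀ s x y, inner ℂ (R s x) (R (s + Real.pi / 2) y) = 0 := fun s x y => by
    rw [hR, inner_rotatedEmbedding h₀ h₁ h₀₁]; simp
  -- `A s` and `A (s + π/2)` are the diagonal blocks and `B s` the off-diagonal one. Bottom
  -- eigenvectors of `A s` are top eigenvectors of the positive operator `P s`; top left singular
  -- vectors of `B s` are top eigenvectors of `N s`.
  let A : ℝ → E →L[ℂ] E := fun s => ContinuousLinearMap.adjoint (R s) ∘L T ∘L R s
  let P : ℝ → E →L[ℂ] E := fun s => (l : ℂ) • ContinuousLinearMap.id ℂ E - A s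
  let B : ℝ → E →L[ℂ] E := fun s => ContinuousLinearMap.adjoint (R s) ∘L T ∘L R (s + Real.pi / 2)
  let N : ℝ → E →L[ℂ] E := fun s => B s ∘L ContinuousLinearMap.adjoint (B s)
  have hadj : Continuous fun s => ContinuousLinearMap.adjoint (R s) :=
    ContinuousLinearMap.adjoint.continuous.comp hRc
  have hAc : Continuous A := hadj.clm_comp (continuous_const.clm_comp hRc)
  have hPc : Continuous P := continuous_const.sub hAc
  have hBc : Continuous B :=
    hadj.clm_comp (continuous_const.clm_comp (hRc.comp (continuous_id.add continuous_const)))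
  have hBadj : Continuous fun s => ContinuousLinearMap.adjoint (B s) :=
    ContinuousLinearMap.adjoint.continuous.comp hBc
  have hNc : Continuous N := hBc.clm_comp hBadj
  have hAi : ∀ s x y, inner ℂ x (A s y) = inner ℂ (R s x) (T (R s y)) := fun s x y => by
    simp [A, ContinuousLinearMap.adjoint_inner_right]
  have hBi : ∀ s x y, inner ℂ x (B s y) = inner ℂ (R s x) (T (R (s + Real.pi / 2) y)) :=
    fun s x y => by simp [B, ContinuousLinearMap.adjoint_inner_right]
  have hPi : ∀ s x, (inner ℂ x (P s x)).re = l * ‖x‖ ^ 2 - (inner ℂ (R s x) (T (R s x))).re :=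
    fun s x => by
      simp only [P, sub_apply, smul_apply, inner_sub_right,
        inner_smul_right, hAi, ContinuousLinearMap.id_apply, Complex.sub_re, Complex.re_ofReal_mul]
      rw [inner_self_eq_norm_sq_to_K]
      norm_cast
  have hquadl : ∀ s x, (inner ℂ (R s x) (T (R s x))).re ≤ l * ‖x‖ ^ 2 := fun s x => by
    by_cases hx : x = 0
    · simp [hx]
    have hx0 : ‖x‖ ≠ 0 := norm_ne_zero_iff.2 hx
    have h := hT.le_top (((‖x‖⁻¹ : ℝ) : ℂ) • R s x) (by
      rw [norm_smul, hRn, Complex.norm_real, norm_inv, norm_norm, inv_mul_cancel₀ hx0])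
    rw [map_smul, inner_smul_left, inner_smul_right, Complex.conj_ofReal, Complex.re_ofReal_mul,
      Complex.re_ofReal_mul] at h
    field_simp at h
    linarith
  have hPpos : ∀ s, (P s).IsPositive := fun s => by
    refine ⟨fun x y => ?_, fun x => ?_⟩
    · have h1 : inner ℂ (A s x) y = inner ℂ x (A s y) := by
        rw [← inner_conj_symm, hAi, hAi, hT.isSymmetric, inner_conj_symm]
      change inner ℂ (P s x) y = inner ℂ x (P s y)
      simp only [P, sub_apply, smul_apply, inner_sub_left, inner_sub_right, inner_smul_left,
        inner_smul_right, ContinuousLinearMap.id_apply, h1, Complex.conj_ofReal]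
    · rw [ContinuousLinearMap.reApplyInnerSelf, inner_re_symm]
      change 0 ≤ (inner ℂ x (P s x)).re
      rw [hPi]
      linarith [hquadl s x]
  have hNpos : ∀ s, (N s).IsPositive := fun s => ContinuousLinearMap.isPositive_self_comp_adjoint _
  have hNn : ∀ s, ‖N s‖ = ‖B s‖ ^ 2 := fun s => norm_self_comp_adjoint _
  have hlow : ∀ s x, (l - ‖P s‖) * ‖x‖ ^ 2 ≤ (inner ℂ (R s x) (T (R s x))).re := fun s x => by
    have h1 : (inner ℂ x (P s x)).re ≤ ‖P s‖ * ‖x‖ ^ 2 := by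
      calc (inner ℂ x (P s x)).re ≤ ‖x‖ * ‖P s x‖ := re_inner_le_norm (𝕜 := ℂ) x (P s x)
        _ ≤ ‖x‖ * (‖P s‖ * ‖x‖) := by gcongr; exact (P s).le_opNorm x
        _ = _ := by ring
    rw [hPi] at h1
    linarith
  have htop : ∀ s, ∀ v ∈ topEigenvectors (P s),
      (inner ℂ (R s v) (T (R s v))).re = l - ‖P s‖ := fun s v hv => by
    have h1 := hPi s v
    rw [hv.2, inner_smul_right, inner_self_eq_norm_sq_to_K, hv.1] at h1
    simp at h1
    linarith
  have hposl : ∀ s, 0 < l - ‖P s‖ := fun s => by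
    obtain ⟨v, hv⟩ := topEigenvectors_nonempty (hPpos s)
    rw [← htop s v hv]
    exact he.trans_le (hT.le_one _ (by rw [hRn, hv.1]))
  suffices hs : ∃ s, ‖B s‖ ≤ √((l - ‖P s‖) * (l - ‖P (s + Real.pi / 2)‖)) by
    obtain ⟨s, hs⟩ := hs
    refine ⟨s, _, _, hposl s, hposl (s + Real.pi / 2), hlow s, hlow _, fun x y => ?_⟩
    rw [← hBi]
    calc ‖inner ℂ x (B s y)‖ ≤ ‖x‖ * ‖B s y‖ := norm_inner_le_norm _ _
      _ ≤ ‖x‖ * (‖B s‖ * ‖y‖) := by gcongr; exact (B s).le_opNorm y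
      _ = ‖B s‖ * (‖x‖ * ‖y‖) := by ring
      _ ≤ _ := by gcongr
  by_cases hB0 : B 0 = 0
  · exact ⟨0, by rw [hB0, norm_zero]; positivity⟩
  let K : Set (ℝ × E × E × E) := {p | p.1 ∈ Set.Icc 0 (Real.pi / 2) ∧
    p.2.1 ∈ topEigenvectors (P p.1) ∧ p.2.2.1 ∈ topEigenvectors (P (p.1 + Real.pi / 2)) ∧
    p.2.2.2 ∈ topEigenvectors (N p.1)}
  have hKc : IsCompact K := by
    refine IsCompact.of_isClosed_subset (isCompact_Icc.prod ((isCompact_sphere (0 : E) 1).prod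
      ((isCompact_sphere (0 : E) 1).prod (isCompact_sphere (0 : E) 1)))) ?_
      (fun p hp => ⟨hp.1, by simpa using hp.2.1.1, by simpa using hp.2.2.1.1,
        by simpa using hp.2.2.2.1⟩)
    refine (isClosed_Icc.preimage continuous_fst).inter (IsClosed.inter ?_ (IsClosed.inter ?_ ?_))
    · exact (isClosed_topEigenvectors_graph hPc).preimage
        (continuous_fst.prodMk (continuous_fst.comp continuous_snd))
    · exact (isClosed_topEigenvectors_graph (hPc.comp (continuous_id.add continuous_const))).preimage
        (continuous_fst.prodMk (continuous_fst.comp (continuous_snd.comp continuous_snd)))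
    · exact (isClosed_topEigenvectors_graph hNc).preimage
        (continuous_fst.prodMk (continuous_snd.comp (continuous_snd.comp continuous_snd)))
  -- For a singular partner `y` of `x` this equals `‖B‖² (|⟨v, x⟩|² - |⟨w, y⟩|²)`. Writing it with
  -- the adjoint of `B` avoids choosing `y` and keeps it continuous where `B` vanishes.
  let f : ℝ × E × E × E → ℝ := fun p => ‖N p.1‖ * ‖inner ℂ p.2.1 p.2.2.2‖ ^ 2 -
    ‖inner ℂ p.2.2.1 (ContinuousLinearMap.adjoint (B p.1) p.2.2.2)‖ ^ 2
  have hf : Continuous f := by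
    refine Continuous.sub (((hNc.comp continuous_fst).norm).mul (by fun_prop)) ?_
    refine Continuous.pow (Continuous.norm (Continuous.inner (by fun_prop) ?_)) 2
    exact (hBadj.comp continuous_fst).clm_apply (by fun_prop)
  have hfib : ∀ s ∈ Set.Icc 0 (Real.pi / 2), {y | (s, y) ∈ K} = topEigenvectors (P s) ×ˢ
      topEigenvectors (P (s + Real.pi / 2)) ×ˢ topEigenvectors (N s) := fun s hs => by
    ext y
    exact and_iff_right hs
  have hpi : 0 ≤ Real.pi / 2 := by positivity
  obtain ⟨v₀, hv₀⟩ := topEigenvectors_nonempty (hPpos 0)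
  obtain ⟨w₀, hw₀⟩ := topEigenvectors_nonempty (hPpos (0 + Real.pi / 2))
  obtain ⟨x₀, hx₀⟩ := topEigenvectors_nonempty (hNpos 0)
  have hp₀ : ((0, v₀, w₀, x₀) : ℝ × E × E × E) ∈ K := ⟨⟨le_rfl, hpi⟩, hv₀, hw₀, hx₀⟩
  -- A quarter turn exchanges the two frames up to a sign, which replaces `B` by `-B*`. Hence `v`
  -- and `w` swap, as do `x` and `y`, and `f` changes sign.
  obtain ⟨p₁, hp₁, hfp⟩ : ∃ p ∈ K, f p = - f (0, v₀, w₀, x₀) := by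
    obtain ⟨y₀, hy₀, hBy, hBx⟩ := exists_singular_partner hB0 hx₀
    have hRpi : ∀ x, R (Real.pi / 2 + Real.pi / 2) x = - R 0 x := fun x => by
      simp [hR, rotatedEmbedding]
    have hPpi : P (Real.pi / 2 + Real.pi / 2) = P 0 := by
      ext1 x
      refine ext_inner_left ℂ fun y => ?_
      simp only [P, sub_apply, inner_sub_right, hAi, hRpi, map_neg, inner_neg_neg]
    have hBpi : B (Real.pi / 2) = - ContinuousLinearMap.adjoint (B 0) := by
      ext1 x
      refine ext_inner_left ℂ fun y => ?_
      rw [hBi, hRpi, map_neg, inner_neg_right, neg_apply, inner_neg_right,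
        ContinuousLinearMap.adjoint_inner_right, ← inner_conj_symm (B 0 y), hBi, zero_add,
        hT.isSymmetric, inner_conj_symm]
    have hBpi' : ContinuousLinearMap.adjoint (B (Real.pi / 2)) = - B 0 := by
      rw [hBpi, map_neg, ContinuousLinearMap.adjoint_adjoint]
    have hNpi : N (Real.pi / 2) = ContinuousLinearMap.adjoint (B 0) ∘L B 0 := by
      ext1 x
      simp only [N, ContinuousLinearMap.comp_apply, hBpi']
      simp [hBpi]
    rw [zero_add] at hw₀
    refine ⟨(Real.pi / 2, w₀, v₀, y₀), ⟨⟨hpi, le_rfl⟩, hw₀, by rwa [hPpi], by rwa [hNpi]⟩, ?_⟩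
    simp only [f]
    rw [hNn, hNn, hBpi', hBpi, norm_neg, LinearIsometryEquiv.norm_map, neg_apply, hBy, hBx,
      inner_neg_right, norm_neg, inner_smul_right, inner_smul_right, norm_mul, norm_mul,
      Complex.norm_real, norm_norm]
    ring
  obtain ⟨⟨s, v, w, x⟩, ⟨hs, hv, hw, hx⟩, hzero⟩ : ∃ p ∈ K, f p = 0 := by
    refine exists_eq_zero_of_isPreconnected_fibers hKc (fun p hp => hp.1) (fun s hs => ?_)
      (fun s hs => ?_) hf ?_ ?_
    · obtain ⟨v, hv⟩ := topEigenvectors_nonempty (hPpos s)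
      obtain ⟨w, hw⟩ := topEigenvectors_nonempty (hPpos (s + Real.pi / 2))
      obtain ⟨x, hx⟩ := topEigenvectors_nonempty (hNpos s)
      exact ⟨(v, w, x), hs, hv, hw, hx⟩
    · rw [hfib s hs]
      exact (isPreconnected_topEigenvectors _).prod
        ((isPreconnected_topEigenvectors _).prod (isPreconnected_topEigenvectors _))
    · rcases le_total 0 (f (0, v₀, w₀, x₀)) with h | h
      · exact ⟨_, hp₀, h⟩
      · exact ⟨_, hp₁, by linarith⟩
    · rcases le_total 0 (f (0, v₀, w₀, x₀)) with h | h
      · exact ⟨_, hp₁, by linarith⟩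
      · exact ⟨_, hp₀, h⟩
  refine ⟨s, ?_⟩
  by_cases hBs : B s = 0
  · rw [hBs, norm_zero]
    positivity
  obtain ⟨y, hy, hBy, hBx⟩ := exists_singular_partner hBs hx
  dsimp only at hv hw hx
  have hmatch : ‖inner ℂ v x‖ = ‖inner ℂ w y‖ := by
    simp only [f] at hzero
    rw [hNn, hBx, inner_smul_right, norm_mul, Complex.norm_real, norm_norm, mul_pow,
      ← mul_sub] at hzero
    have hne : ‖B s‖ ^ 2 ≠ 0 := by simpa using hBs
    have := (mul_eq_zero.1 hzero).resolve_left hne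
    exact (sq_eq_sq₀ (norm_nonneg _) (norm_nonneg _)).1 (by linarith)
  have main := hT.re_inner_le_sqrt hE hb he hl (hRi s) (hRi (s + Real.pi / 2)) (hRo s)
    hx.1 hy.1 hv.1 hw.1 hmatch
  rw [htop s v hv, htop _ w hw, ← hBi, hBy, inner_smul_right, inner_self_eq_norm_sq_to_K,
    hx.1] at main
  simpa using main

end RotatedFrames

/-! ### The cone of separable operators. -/

section SeparableCone

variable {m n : Type} [Fintype m] [Fintype n]

/-- The cone of unnormalised separable operators: finite sums of products of positive semidefinite
matrices. -/
def separableCone (m n : Type) : AddSubmonoid (Matrix (m × n) (m × n) ℂ) :=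
  AddSubmonoid.closure {M | ∃ (P : Matrix m m ℂ) (Q : Matrix n n ℂ),
    P.PosSemidef ∧ Q.PosSemidef ∧ M = P ⊗ₖ Q}

omit [Fintype m] [Fintype n] in
lemma kronecker_mem_separableCone {P : Matrix m m ℂ} {Q : Matrix n n ℂ} (hP : P.PosSemidef)
    (hQ : Q.PosSemidef) : P ⊗ₖ Q ∈ separableCone m n :=
  AddSubmonoid.subset_closure ⟨P, Q, hP, hQ, rfl⟩

/-- The separable cone is invariant under local filters on the first factor. -/
lemma conj_mem_separableCone [DecidableEq n] (F : Matrix m m ℂ) {M : Matrix (m × n) (m × n) ℂ}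
    (hM : M ∈ separableCone m n) :
    (F ⊗ₖ (1 : Matrix n n ℂ))ᴴ * M * (F ⊗ₖ (1 : Matrix n n ℂ)) ∈ separableCone m n := by
  induction hM using AddSubmonoid.closure_induction with
  | mem M hM =>
    obtain ⟨P, Q, hP, hQ, rfl⟩ := hM
    have : (F ⊗ₖ (1 : Matrix n n ℂ))ᴴ * (P ⊗ₖ Q) * (F ⊗ₖ (1 : Matrix n n ℂ)) =
        (Fᴴ * P * F) ⊗ₖ Q := by
      rw [Matrix.conjTranspose_kronecker, ← Matrix.mul_kronecker_mul, ← Matrix.mul_kronecker_mul]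
      simp
    rw [this]
    exact kronecker_mem_separableCone (hP.conjTranspose_mul_mul_same F) hQ
  | zero => simp
  | add M N _ _ hM hN =>
    rw [Matrix.mul_add, Matrix.add_mul]
    exact add_mem hM hN

/-- The density matrices of product states. -/
abbrev productStates (m n : Type) [Fintype m] [Fintype n] : Set (Matrix (m × n) (m × n) ℂ) :=
  {τ | ∃ (α : QState m) (β : QState n), τ = α.1 ⊗ₖ β.1}

omit [Fintype n] in
lemma exists_normalized {P : Matrix m m ℂ} (hP : P.PosSemidef) (h0 : P ≠ 0) :
    ∃ (t : ℝ) (α : QState m), 0 < t ∧ P = t • α.1 := by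
  have hre : P.trace = (P.trace.re : ℂ) := by
    have := (Complex.le_def.1 hP.trace_nonneg).2
    exact Complex.ext rfl (by simpa using this.symm)
  have htr : 0 < P.trace.re := lt_of_le_of_ne (Complex.le_def.1 hP.trace_nonneg).1 fun h =>
    h0 (hP.trace_eq_zero_iff.1 (by rw [hre, ← h]; simp))
  refine ⟨P.trace.re, ⟨P.trace.re⁻¹ • P, hP.smul (inv_nonneg.2 htr.le), ?_⟩, htr, ?_⟩
  · rw [Matrix.trace_smul, Complex.real_smul]
    conv_lhs => rw [hre]
    rw [Complex.ofReal_re, ← Complex.ofReal_mul, inv_mul_cancel₀ htr.ne', Complex.ofReal_one]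
  · rw [smul_smul, mul_inv_cancel₀ htr.ne', one_smul]

/-- Each positive semidefinite factor is zero or a positive multiple of a state, and sums of
positive multiples renormalise to convex combinations. -/
lemma exists_smul_mem_convexHull {M : Matrix (m × n) (m × n) ℂ} (hM : M ∈ separableCone m n) :
    M = 0 ∨ ∃ t : ℝ, 0 < t ∧ ∃ N ∈ convexHull ℝ (productStates m n), M = t • N := by
  induction hM using AddSubmonoid.closure_induction with
  | mem M hM =>
    obtain ⟨P, Q, hP, hQ, rfl⟩ := hM
    by_cases hP0 : P = 0
    · left; simp [hP0]
    by_cases hQ0 : Q = 0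
    · left; simp [hQ0]
    obtain ⟨s, α, hs, rfl⟩ := exists_normalized hP hP0
    obtain ⟨t, β, ht, rfl⟩ := exists_normalized hQ hQ0
    refine Or.inr ⟨s * t, mul_pos hs ht, _, subset_convexHull _ _ ⟨α, β, rfl⟩, ?_⟩
    rw [Matrix.smul_kronecker, Matrix.kronecker_smul, smul_smul]
  | zero => exact Or.inl rfl
  | add M N _ _ hM hN =>
    rcases hM with rfl | ⟨s, hs, M, hM, rfl⟩
    · simpa using hN
    rcases hN with rfl | ⟨t, ht, N, hN, rfl⟩
    · exact Or.inr ⟨s, hs, M, hM, by simp⟩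
    refine Or.inr ⟨s + t, add_pos hs ht, (s / (s + t)) • M + (t / (s + t)) • N,
      convex_convexHull ℝ _ hM hN (by positivity) (by positivity) (by field_simp), ?_⟩
    rw [smul_add, smul_smul, smul_smul]
    congr 2 <;> field_simp

lemma trace_eq_one_of_mem_convexHull {M : Matrix (m × n) (m × n) ℂ}
    (hM : M ∈ convexHull ℝ (productStates m n)) : M.trace = 1 := by
  have hconv : Convex ℝ {M : Matrix (m × n) (m × n) ℂ | M.trace = 1} := by
    intro M hM N hN a b _ _ hab
    simp only [Set.mem_ofPred_eq] at hM hN ⊢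
    rw [Matrix.trace_add, Matrix.trace_smul, Matrix.trace_smul, hM, hN, ← add_smul, hab, one_smul]
  refine convexHull_min ?_ hconv hM
  rintro _ ⟨α, β, rfl⟩
  simp [Matrix.trace_kronecker, α.2.2, β.2.2]

/-- A state in the separable cone is separable. -/
lemma isSeparable_of_mem_separableCone (ρ : QState (m × n)) (h : ρ.1 ∈ separableCone m n) :
    QIsSeparable ρ := by
  rcases exists_smul_mem_convexHull h with h0 | ⟨t, _, N, hN, hρ⟩
  · have := ρ.2.2
    simp [h0] at this
  · have h1 := ρ.2.2
    rw [hρ, Matrix.trace_smul, trace_eq_one_of_mem_convexHull hN] at h1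
    have : t = 1 := by simpa using h1
    rw [this, one_smul] at hρ
    rw [QIsSeparable, hρ]
    exact hN

end SeparableCone

/-! ### Separability of dominated block matrices. -/

section Blocks

variable {n : Type} [Fintype n] [DecidableEq n]

/-- The `2 × 2` block matrix with blocks `A`, `B`, `C`, `D`. -/
def blockMatrix {n : Type} (A B C D : Matrix n n ℂ) : Matrix (Fin 2 × n) (Fin 2 × n) ℂ :=
  Matrix.of fun p q => !![A, B; C, D] p.1 q.1 p.2 q.2

omit [Fintype n] [DecidableEq n] in
lemma blockMatrix_submatrix (A B C D : Matrix n n ℂ) :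
    (blockMatrix A B C D).submatrix (Sum.elim (fun x => (0, x)) fun x => (1, x))
      (Sum.elim (fun x => (0, x)) fun x => (1, x)) = Matrix.fromBlocks A B C D := by
  ext (i | i) (j | j) <;> rfl

omit [Fintype n] [DecidableEq n] in
lemma single_kronecker_add (A D : Matrix n n ℂ) :
    (Matrix.single 0 0 1 : Matrix (Fin 2) (Fin 2) ℂ) ⊗ₖ A +
      (Matrix.single 1 1 1 : Matrix (Fin 2) (Fin 2) ℂ) ⊗ₖ D = blockMatrix A 0 0 D := by
  ext ⟨i, x⟩ ⟨j, y⟩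
  fin_cases i <;> fin_cases j <;> simp [blockMatrix]

omit [Fintype n] [DecidableEq n] in
lemma blockMatrix_diagonal_mem {A D : Matrix n n ℂ} (hA : A.PosSemidef) (hD : D.PosSemidef) :
    blockMatrix A 0 0 D ∈ separableCone (Fin 2) n := by
  have hs : ∀ i : Fin 2, (Matrix.single i i (1 : ℂ)).PosSemidef := fun i => by
    have := Matrix.posSemidef_vecMulVec_self_star (Pi.single i (1 : ℂ))
    convert this using 1
    ext a b
    fin_cases i <;> fin_cases a <;> fin_cases b <;> simp [Matrix.vecMulVec_apply]
  rw [← single_kronecker_add]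
  exact add_mem (kronecker_mem_separableCone (hs 0) hA) (kronecker_mem_separableCone (hs 1) hD)

open scoped MatrixOrder in
/-- A positive semidefinite block matrix that is invariant under partial transposition is
separable. -/
lemma blockMatrix_mem_of_isHermitian {P Q R : Matrix n n ℂ} (hP : P.PosDef) (hQ : Q.IsHermitian)
    (h : (Matrix.fromBlocks P Q Q R).PosSemidef) :
    blockMatrix P Q Q R ∈ separableCone (Fin 2) n := by
  obtain ⟨L, hL, hPL⟩ : ∃ L : Matrix n n ℂ, IsUnit L ∧ P = Lᴴ * L := by
    have hsqrt : CFC.sqrt P * CFC.sqrt P = P :=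
      CFC.sqrt_mul_sqrt_self P (Matrix.nonneg_iff_posSemidef.2 hP.posSemidef)
    have hsa : (CFC.sqrt P)ᴴ = CFC.sqrt P :=
      (Matrix.nonneg_iff_posSemidef.1 (CFC.sqrt_nonneg P)).isHermitian
    refine ⟨CFC.sqrt P, ?_, by rw [hsa, hsqrt]⟩
    have := hP.isUnit
    rw [← hsqrt, Matrix.isUnit_iff_isUnit_det, Matrix.det_mul] at this
    exact (Matrix.isUnit_iff_isUnit_det _).2 (isUnit_of_mul_isUnit_left this)
  have hLdet : IsUnit L.det := (Matrix.isUnit_iff_isUnit_det _).1 hL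
  have hX : ((L⁻¹)ᴴ * Q * L⁻¹).IsHermitian := Matrix.isHermitian_conjTranspose_mul_mul _ hQ
  -- Simultaneous diagonalisation by congruence: `P` is reduced to the identity by its square root,
  -- then the Hermitian `Q` is diagonalised unitarily.
  obtain ⟨Z, h, hZ, hPZ, hQZ⟩ : ∃ (Z : Matrix n n ℂ) (h : n → ℝ), IsUnit Z ∧ P = Z * Zᴴ ∧
      Q = Z * Matrix.diagonal (fun i => (h i : ℂ)) * Zᴴ := by
    set U : Matrix n n ℂ := (hX.eigenvectorUnitary : Matrix n n ℂ) with hU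
    have hUU : U * Uᴴ = 1 := Unitary.mul_star_self_of_mem hX.eigenvectorUnitary.2
    have hspec : (L⁻¹)ᴴ * Q * L⁻¹ =
        U * Matrix.diagonal (fun i => (hX.eigenvalues i : ℂ)) * Uᴴ := by
      conv_lhs => rw [hX.spectral_theorem]
      rw [Unitary.conjStarAlgAut_apply]
      rfl
    have hLL : L⁻¹ * L = 1 := Matrix.nonsing_inv_mul _ hLdet
    have hLL' : Lᴴ * (L⁻¹)ᴴ = 1 := by
      rw [← Matrix.conjTranspose_mul, hLL, Matrix.conjTranspose_one]
    clear_value U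
    generalize hX.eigenvalues = ev at hspec
    refine ⟨Lᴴ * U, ev, ?_, ?_, ?_⟩
    · exact ((Matrix.isUnit_conjTranspose _).2 hL).mul
        (IsUnit.of_mul_eq_one _ hUU)
    · rw [Matrix.conjTranspose_mul, Matrix.conjTranspose_conjTranspose, Matrix.mul_assoc,
        ← Matrix.mul_assoc U, hUU, Matrix.one_mul, hPL]
    · calc Q = (Lᴴ * (L⁻¹)ᴴ) * Q * (L⁻¹ * L) := by rw [hLL, hLL', Matrix.one_mul, Matrix.mul_one]
        _ = Lᴴ * ((L⁻¹)ᴴ * Q * L⁻¹) * L := by simp only [Matrix.mul_assoc]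
        _ = _ := by
          rw [hspec, Matrix.conjTranspose_mul, Matrix.conjTranspose_conjTranspose]
          simp only [Matrix.mul_assoc]
  -- The subtracted term is `Qᴴ * P⁻¹ * Q`, so this is positivity of the Schur complement.
  have hR : (R - Z * Matrix.diagonal (fun i => (h i : ℂ) ^ 2) * Zᴴ).PosSemidef := by
    have hZdet : IsUnit Z.det := (Matrix.isUnit_iff_isUnit_det _).1 hZ
    have hZdet' : IsUnit Zᴴ.det := (Matrix.isUnit_iff_isUnit_det _).1
      ((Matrix.isUnit_conjTranspose _).2 hZ)
    let := hP.isUnit.invertible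
    have hschur := (Matrix.PosDef.fromBlocks₁₁ Q R hP).1 (by rwa [hQ])
    have hinv : P⁻¹ = (Zᴴ)⁻¹ * Z⁻¹ := by rw [hPZ, Matrix.mul_inv_rev]
    suffices hkey : Z * Matrix.diagonal (fun i => (h i : ℂ) ^ 2) * Zᴴ = Qᴴ * P⁻¹ * Q by
      rwa [hkey]
    rw [hQ, hinv]
    set D := Matrix.diagonal (fun i => (h i : ℂ)) with hD
    have hDD : Matrix.diagonal (fun i => (h i : ℂ) ^ 2) = D * D := by
      rw [hD, Matrix.diagonal_mul_diagonal]
      simp [sq]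
    rw [hDD, hQZ]
    calc Z * (D * D) * Zᴴ = Z * D * (Zᴴ * (Zᴴ)⁻¹) * (Z⁻¹ * Z) * D * Zᴴ := by
          rw [Matrix.mul_nonsing_inv _ hZdet', Matrix.nonsing_inv_mul _ hZdet]
          simp only [Matrix.mul_one, Matrix.mul_assoc]
      _ = _ := by simp only [Matrix.mul_assoc]
  -- Each column `z` of `Z` contributes the product of the rank one projector on `(1, h)` with that
  -- on `z`, up to scale; the Schur complement is left over in the corner.
  have hdecomp : blockMatrix P Q Q R = (∑ k, (!![1, (h k : ℂ); (h k : ℂ), (h k : ℂ) ^ 2]) ⊗ₖ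
      Matrix.vecMulVec (fun i => Z i k) (star fun i => Z i k)) +
      blockMatrix 0 0 0 (R - Z * Matrix.diagonal (fun i => (h i : ℂ) ^ 2) * Zᴴ) := by
    have hentry : ∀ (g : n → ℂ) (x y : n), (Z * Matrix.diagonal g * Zᴴ) x y =
        ∑ k, g k * (Z x k * star (Z y k)) := fun g x y => by
      rw [Matrix.mul_apply]
      exact Finset.sum_congr rfl fun k _ => by
        rw [Matrix.mul_diagonal, Matrix.conjTranspose_apply]; ring
    have hP' : ∀ x y, P x y = ∑ k, Z x k * star (Z y k) := fun x y => by
      rw [hPZ, Matrix.mul_apply]; rfl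
    have hQ' : ∀ x y, Q x y = ∑ k, h k * (Z x k * star (Z y k)) := fun x y => by
      rw [hQZ, hentry]
    ext ⟨i, x⟩ ⟨j, y⟩
    rw [Matrix.add_apply, Matrix.sum_apply]
    fin_cases i <;> fin_cases j <;>
      simp [blockMatrix, hP', hQ', hentry, Matrix.vecMulVec_apply]
  rw [hdecomp]
  refine add_mem (sum_mem fun k _ => kronecker_mem_separableCone ?_ 
    (Matrix.posSemidef_vecMulVec_self_star _)) (blockMatrix_diagonal_mem Matrix.PosSemidef.zero hR)
  have := Matrix.posSemidef_vecMulVec_self_star (![1, (h k : ℂ)])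
  convert this using 1
  ext a b
  fin_cases a <;> fin_cases b <;> simp [Matrix.vecMulVec_apply, sq]

lemma conj_kronecker_one_apply (F : Matrix (Fin 2) (Fin 2) ℂ) (M : Matrix (Fin 2 × n) (Fin 2 × n) ℂ)
    (i j : Fin 2) (x y : n) :
    ((F ⊗ₖ (1 : Matrix n n ℂ))ᴴ * M * (F ⊗ₖ (1 : Matrix n n ℂ))) (i, x) (j, y) =
      ∑ l, ∑ k, star (F k i) * M (k, x) (l, y) * F l j := by
  simp only [Matrix.mul_apply, Fintype.sum_prod_type, Matrix.conjTranspose_apply,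
    Matrix.kroneckerMap_apply, Matrix.one_apply]
  simp [apply_ite (starRingEnd ℂ), ite_mul]
  ring

/-- A positive definite block matrix with scalar diagonal blocks is separable. -/
lemma blockMatrix_scalar_mem {α β : ℝ} (hα : 0 < α) (hβ : 0 < β) (B : Matrix n n ℂ)
    (h : (blockMatrix ((α : ℂ) • 1) B Bᴴ ((β : ℂ) • 1)).PosDef) :
    blockMatrix ((α : ℂ) • 1) B Bᴴ ((β : ℂ) • 1) ∈ separableCone (Fin 2) n := by
  set M := blockMatrix ((α : ℂ) • 1) B Bᴴ ((β : ℂ) • 1) with hM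
  set a : ℝ := (√α)⁻¹ with ha
  set b : ℝ := (√β)⁻¹ with hb
  have ha0 : (a : ℂ) ≠ 0 := by rw [ha]; norm_cast; positivity
  have hb0 : (b : ℂ) ≠ 0 := by rw [hb]; norm_cast; positivity
  have haα : (a : ℂ) ^ 2 * α = 1 := by
    rw [ha]; norm_cast; rw [inv_pow, Real.sq_sqrt hα.le]; field_simp
  have hbβ : (b : ℂ) ^ 2 * β = 1 := by
    rw [hb]; norm_cast; rw [inv_pow, Real.sq_sqrt hβ.le]; field_simp
  -- The factors `a`, `b` normalise both scalar blocks to the identity. The combinations `(1, 1)`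
  -- and `(i, -i)` then make both off-diagonal blocks the same Hermitian matrix, which is invariance
  -- under partial transposition.
  let F : Matrix (Fin 2) (Fin 2) ℂ := !![(a : ℂ), Complex.I * a; (b : ℂ), -(Complex.I * b)]
  have hF : IsUnit F := by
    rw [Matrix.isUnit_iff_isUnit_det, isUnit_iff_ne_zero]
    simp only [F, Matrix.det_fin_two_of]
    rw [show (a : ℂ) * -(Complex.I * b) - Complex.I * a * b = -(2 * Complex.I * (a * b)) by ring]
    simp [ha0, hb0]
  set G := F ⊗ₖ (1 : Matrix n n ℂ) with hG
  let P : Matrix n n ℂ := (2 : ℂ) • 1 + (a * b : ℂ) • (B + Bᴴ)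
  let Q : Matrix n n ℂ := (Complex.I * (a * b)) • (Bᴴ - B)
  let R : Matrix n n ℂ := (2 : ℂ) • 1 - (a * b : ℂ) • (B + Bᴴ)
  have hGM : Gᴴ * M * G = blockMatrix P Q Q R := by
    ext ⟨i, x⟩ ⟨j, y⟩
    rw [hG, conj_kronecker_one_apply]
    fin_cases i <;> fin_cases j <;> simp [F, P, Q, R, M, blockMatrix, Fin.sum_univ_two]
    · linear_combination (1 : Matrix n n ℂ) x y * (haα + hbβ)
    · linear_combination Complex.I * (1 : Matrix n n ℂ) x y * (haα - hbβ)
    · linear_combination Complex.I * (1 : Matrix n n ℂ) x y * (hbβ - haα)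
    · linear_combination (1 : Matrix n n ℂ) x y * (haα + hbβ) + (a * b * ((starRingEnd ℂ) (B y x) + B x y) -
        (1 : Matrix n n ℂ) x y * (a ^ 2 * α + b ^ 2 * β)) * Complex.I_sq
  have hGu : IsUnit G := Matrix.IsUnit.kronecker hF isUnit_one
  have hpd : (blockMatrix P Q Q R).PosDef := by
    rw [← hGM]
    exact (Matrix.IsUnit.posDef_star_left_conjugate_iff hGu).2 h
  have hmem : blockMatrix P Q Q R ∈ separableCone (Fin 2) n := by
    refine blockMatrix_mem_of_isHermitian ?_ ?_ ?_
    · exact hpd.submatrix (e := fun x => ((0 : Fin 2), x)) (fun x y hxy => (Prod.ext_iff.1 hxy).2)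
    · simp only [Q, Matrix.IsHermitian, Matrix.conjTranspose_smul, Matrix.conjTranspose_sub,
        Matrix.conjTranspose_conjTranspose]
      rw [← neg_sub B, smul_neg, ← neg_smul]
      congr 1
      simp
    · rw [← blockMatrix_submatrix]
      exact hpd.posSemidef.submatrix _
  rw [← hGM] at hmem
  have hFF : F * F⁻¹ = 1 := Matrix.mul_nonsing_inv _ ((Matrix.isUnit_iff_isUnit_det _).1 hF)
  have hGG : G * (F⁻¹ ⊗ₖ (1 : Matrix n n ℂ)) = 1 := by
    rw [hG, ← Matrix.mul_kronecker_mul, hFF, Matrix.one_mul, Matrix.one_kronecker_one]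
  have := conj_mem_separableCone F⁻¹ hmem
  convert this using 1
  rw [Matrix.mul_assoc, Matrix.mul_assoc, Matrix.mul_assoc, hGG, Matrix.mul_one, ← Matrix.mul_assoc,
    ← Matrix.conjTranspose_mul, hGG, Matrix.conjTranspose_one, Matrix.one_mul]

/-- A block matrix is separable if its off-diagonal block is dominated by lower bounds of the
diagonal blocks. -/
lemma blockMatrix_mem {A B C : Matrix n n ℂ} {α β : ℝ} (hα : 0 < α) (hβ : 0 < β)
    (hA : (A - (α : ℂ) • 1).PosSemidef) (hC : (C - (β : ℂ) • 1).PosSemidef)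
    (h : (blockMatrix ((α : ℂ) • 1) B Bᴴ ((β : ℂ) • 1)).PosDef) :
    blockMatrix A B Bᴴ C ∈ separableCone (Fin 2) n := by
  have : blockMatrix A B Bᴴ C = blockMatrix (A - (α : ℂ) • 1) 0 0 (C - (β : ℂ) • 1) +
      blockMatrix ((α : ℂ) • 1) B Bᴴ ((β : ℂ) • 1) := by
    ext ⟨i, x⟩ ⟨j, y⟩
    fin_cases i <;> fin_cases j <;> simp [blockMatrix]
  rw [this]
  exact add_mem (blockMatrix_diagonal_mem hA hC) (blockMatrix_scalar_mem hα hβ B h)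

end Blocks

/-! ### From operators on Euclidean space to matrices. -/

section Bridge

variable {n : Type} [Fintype n] [DecidableEq n]

/-- The vector `eᵢ ⊗ x`. -/
def blockVec {n : Type} (i : Fin 2) (x : n → ℂ) : Fin 2 × n → ℂ := fun p => if p.1 = i then x p.2 else 0

omit [DecidableEq n] in
lemma star_blockVec_dotProduct_mulVec (M : Matrix (Fin 2 × n) (Fin 2 × n) ℂ) (i j : Fin 2)
    (x y : n → ℂ) : star (blockVec i x) ⬝ᵥ M *ᵥ blockVec j y =
      star x ⬝ᵥ (Matrix.of fun a b => M (i, a) (j, b)) *ᵥ y := by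
  simp only [dotProduct, Matrix.mulVec, Fintype.sum_prod_type, blockVec, Pi.star_apply, Matrix.of_apply]
  fin_cases i <;> fin_cases j <;> simp

/-- The embedding `x ↦ eᵢ ⊗ x` of Euclidean spaces. -/
noncomputable def blockEmbedding (n : Type) [Fintype n] (i : Fin 2) :
    EuclideanSpace ℂ n →L[ℂ] EuclideanSpace ℂ (Fin 2 × n) :=
  LinearMap.toContinuousLinearMap
    { toFun := fun x => WithLp.toLp 2 (blockVec i x.ofLp)
      map_add' := fun x y => by
        ext p; simp only [blockVec, PiLp.add_apply]; split_ifs <;> simp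
      map_smul' := fun c x => by
        ext p; simp only [blockVec, PiLp.smul_apply]; split_ifs <;> simp }

omit [DecidableEq n] in
lemma blockEmbedding_apply (i : Fin 2) (x : EuclideanSpace ℂ n) :
    blockEmbedding n i x = WithLp.toLp 2 (blockVec i x.ofLp) := rfl

omit [DecidableEq n] in
lemma inner_blockEmbedding_self (i : Fin 2) (x y : EuclideanSpace ℂ n) :
    inner ℂ (blockEmbedding n i x) (blockEmbedding n i y) = inner ℂ x y := by
  simp only [blockEmbedding_apply, PiLp.inner_apply, Fintype.sum_prod_type, blockVec]
  fin_cases i <;> simp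

omit [DecidableEq n] in
lemma inner_blockEmbedding_zero_one (x y : EuclideanSpace ℂ n) :
    inner ℂ (blockEmbedding n 0 x) (blockEmbedding n 1 y) = 0 := by
  simp only [blockEmbedding_apply, PiLp.inner_apply, Fintype.sum_prod_type, blockVec]
  simp

lemma inner_toEuclideanCLM {m : Type} [Fintype m] [DecidableEq m] (M : Matrix m m ℂ)
    (x y : EuclideanSpace ℂ m) :
    inner ℂ x (Matrix.toEuclideanCLM (𝕜 := ℂ) M y) = star x.ofLp ⬝ᵥ M *ᵥ y.ofLp := by
  rw [EuclideanSpace.inner_eq_star_dotProduct, dotProduct_comm]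
  rfl

lemma star_star_dotProduct_mulVec {m : Type} [Fintype m] (M : Matrix m m ℂ) (x y : m → ℂ) :
    star (star x ⬝ᵥ M *ᵥ y) = star y ⬝ᵥ Mᴴ *ᵥ x := by
  rw [Matrix.star_dotProduct (v := y), Matrix.star_mulVec, Matrix.conjTranspose_conjTranspose,
    ← Matrix.dotProduct_mulVec]

lemma isHermitian_im_eq_zero {m : Type} [Fintype m] {M : Matrix m m ℂ} (hM : M.IsHermitian)
    (x : m → ℂ) : (star x ⬝ᵥ M *ᵥ x).im = 0 := by
  have h : star (star x ⬝ᵥ M *ᵥ x) = star x ⬝ᵥ M *ᵥ x := by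
    rw [star_star_dotProduct_mulVec, hM.eq]
  exact Complex.conj_eq_iff_im.1 h

lemma posSemidef_of_re_nonneg {m : Type} [Fintype m] {M : Matrix m m ℂ} (hM : M.IsHermitian)
    (h : ∀ x, 0 ≤ (star x ⬝ᵥ M *ᵥ x).re) : M.PosSemidef :=
  Matrix.PosSemidef.of_dotProduct_mulVec_nonneg hM fun x =>
    Complex.le_def.2 ⟨h x, (isHermitian_im_eq_zero hM x).symm⟩

lemma posDef_of_re_pos {m : Type} [Fintype m] {M : Matrix m m ℂ} (hM : M.IsHermitian)
    (h : ∀ x, x ≠ 0 → 0 < (star x ⬝ᵥ M *ᵥ x).re) : M.PosDef :=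
  Matrix.PosDef.of_dotProduct_mulVec_pos hM fun x hx =>
    Complex.lt_def.2 ⟨h x hx, (isHermitian_im_eq_zero hM x).symm⟩

lemma star_dotProduct_self_eq {m : Type} [Fintype m] (x : m → ℂ) :
    star x ⬝ᵥ x = ((‖(WithLp.toLp 2 x : EuclideanSpace ℂ m)‖ ^ 2 : ℝ) : ℂ) := by
  have := inner_self_eq_norm_sq_to_K (𝕜 := ℂ) (WithLp.toLp 2 x : EuclideanSpace ℂ m)
  rw [EuclideanSpace.inner_eq_star_dotProduct, dotProduct_comm] at this
  rw [this]
  simp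

/-- A block matrix with scalar diagonal blocks `α`, `β` is positive definite if its off-diagonal
block is dominated. -/
lemma blockMatrix_scalar_posDef {α β δ : ℝ} (hα : 0 ≤ α) (hβ : 0 ≤ β) (hδ : 0 < δ) {B : Matrix n n ℂ}
    (hB : ∀ x y : EuclideanSpace ℂ n, ‖star x.ofLp ⬝ᵥ B *ᵥ y.ofLp‖ ≤ √(α * β) * (‖x‖ * ‖y‖)) :
    (blockMatrix (((α + δ : ℝ) : ℂ) • 1) B Bᴴ (((β + δ : ℝ) : ℂ) • 1)).PosDef := by
  refine posDef_of_re_pos ?_ fun z hz => ?_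
  · ext ⟨i, x⟩ ⟨j, y⟩
    rw [Matrix.conjTranspose_apply]
    fin_cases i <;> fin_cases j <;> simp [blockMatrix, Matrix.one_apply, eq_comm (a := y), apply_ite] <;>
      split_ifs <;> simp_all
  · set x : n → ℂ := fun a => z (0, a) with hx
    set y : n → ℂ := fun a => z (1, a) with hy
    have hzxy : z = blockVec 0 x + blockVec 1 y := by
      ext ⟨i, a⟩
      fin_cases i <;> simp [blockVec, hx, hy]
    have hBH : star y ⬝ᵥ Bᴴ *ᵥ x = star (star x ⬝ᵥ B *ᵥ y) :=
      (star_star_dotProduct_mulVec B x y).symm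
    have hval : star z ⬝ᵥ (blockMatrix (((α + δ : ℝ) : ℂ) • 1) B Bᴴ (((β + δ : ℝ) : ℂ) • 1)) *ᵥ z =
        (α + δ : ℝ) * (star x ⬝ᵥ x) + star x ⬝ᵥ B *ᵥ y + star (star x ⬝ᵥ B *ᵥ y) +
          (β + δ : ℝ) * (star y ⬝ᵥ y) := by
      rw [← hBH]
      conv_lhs => rw [hzxy]
      rw [star_add, Matrix.mulVec_add, add_dotProduct, dotProduct_add, dotProduct_add]
      simp only [star_blockVec_dotProduct_mulVec]
      have e1 : (Matrix.of fun a b => blockMatrix (((α + δ : ℝ) : ℂ) • 1) B Bᴴ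
        (((β + δ : ℝ) : ℂ) • 1) (0, a) (0, b)) = ((α + δ : ℝ) : ℂ) • (1 : Matrix n n ℂ) := rfl
      have e2 : (Matrix.of fun a b => blockMatrix (((α + δ : ℝ) : ℂ) • 1) B Bᴴ
        (((β + δ : ℝ) : ℂ) • 1) (0, a) (1, b)) = B := rfl
      have e3 : (Matrix.of fun a b => blockMatrix (((α + δ : ℝ) : ℂ) • 1) B Bᴴ
        (((β + δ : ℝ) : ℂ) • 1) (1, a) (0, b)) = Bᴴ := rfl
      have e4 : (Matrix.of fun a b => blockMatrix (((α + δ : ℝ) : ℂ) • 1) B Bᴴ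
        (((β + δ : ℝ) : ℂ) • 1) (1, a) (1, b)) = ((β + δ : ℝ) : ℂ) • (1 : Matrix n n ℂ) := rfl
      rw [e1, e2, e3, e4, Matrix.smul_mulVec, Matrix.smul_mulVec, Matrix.one_mulVec,
        Matrix.one_mulVec, dotProduct_smul, dotProduct_smul, smul_eq_mul, smul_eq_mul]
      ring
    rw [hval, star_dotProduct_self_eq, star_dotProduct_self_eq, ← Complex.ofReal_mul,
      ← Complex.ofReal_mul]
    simp only [Complex.add_re, Complex.ofReal_re, Complex.star_def, Complex.conj_re]
    have hb := hB (WithLp.toLp 2 x) (WithLp.toLp 2 y)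
    have hre := (abs_le.1 (Complex.abs_re_le_norm (star x ⬝ᵥ B *ᵥ y))).1
    set p := ‖(WithLp.toLp 2 x : EuclideanSpace ℂ n)‖ with hp
    set q := ‖(WithLp.toLp 2 y : EuclideanSpace ℂ n)‖ with hq
    have hpq : 0 < p ^ 2 + q ^ 2 := by
      by_contra hcon
      have hp0 : p = 0 := by nlinarith [sq_nonneg p, sq_nonneg q]
      have hq0 : q = 0 := by nlinarith [sq_nonneg p, sq_nonneg q]
      rw [hp, norm_eq_zero] at hp0
      rw [hq, norm_eq_zero] at hq0
      apply hz
      have hx0 : x = 0 := by simpa using congrArg WithLp.ofLp hp0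
      have hy0 : y = 0 := by simpa using congrArg WithLp.ofLp hq0
      rw [hzxy, hx0, hy0]
      ext p
      simp [blockVec]
    rw [Real.sqrt_mul hα] at hb
    have h1 := Real.sq_sqrt hα
    have h2 := Real.sq_sqrt hβ
    -- The form is at least `(√α p - √β q)² + δ (p² + q²)`.
    nlinarith [sq_nonneg (√α * p - √β * q), mul_pos hδ hpq]

/-- A positive operator on `ℂ² ⊗ ℂⁿ` whose eigenvalues satisfy, with some slack `δ`, the inequality
`λ₁ - λ₂ₙ₋₁ ≤ 2 √(λ₂ₙ₋₂ λ₂ₙ)` is separable. -/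
theorem mem_separableCone_of_spectralBounds (hn : 1 < Fintype.card n)
    {M : Matrix (Fin 2 × n) (Fin 2 × n) ℂ} (hM : M.IsHermitian) {δ l b c e : ℝ} (hδ : 0 < δ)
    (hT : SpectralBounds (Matrix.toEuclideanCLM (𝕜 := ℂ) (M - (δ : ℂ) • 1)) l b c e)
    (hb : 0 ≤ b) (he : 0 < e) (hl : l ≤ c + 2 * √(b * e)) : M ∈ separableCone (Fin 2) n := by
  -- The rotation is found for `M - δ`. Adding `δ` back leaves `B` unchanged and raises both
  -- diagonal bounds, which upgrades domination to positive definiteness.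
  obtain ⟨s, α, β, hα, hβ, hA, hC, hB⟩ := hT.exists_rotation (E := EuclideanSpace ℂ n)
    (by simpa using hn) hb he hl (inner_blockEmbedding_self 0) (inner_blockEmbedding_self 1)
    inner_blockEmbedding_zero_one
  set φ : Fin 2 → ℝ := ![s, s + Real.pi / 2] with hφ
  set G : Matrix (Fin 2) (Fin 2) ℂ := Matrix.of fun i j =>
    ![(Real.cos (φ j) : ℂ), (Real.sin (φ j) : ℂ)] i with hG
  have hGG : Gᴴ * G = 1 := by
    have hs : (Complex.cos s) ^ 2 + (Complex.sin s) ^ 2 = 1 := Complex.cos_sq_add_sin_sq s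
    ext i j
    fin_cases i <;> fin_cases j <;>
      simp [hG, hφ, Matrix.mul_apply, Fin.sum_univ_two, Complex.cos_add_pi_div_two, Complex.sin_add_pi_div_two,
        ← Complex.cos_conj, ← Complex.sin_conj] <;> grind
  set K := G ⊗ₖ (1 : Matrix n n ℂ) with hK
  have hKK : Kᴴ * K = 1 := by
    rw [hK, Matrix.conjTranspose_kronecker, ← Matrix.mul_kronecker_mul, hGG]
    simp
  have hKK' : K * Kᴴ = 1 := mul_eq_one_comm.1 hKK
  set M' := Kᴴ * M * K with hM'
  have hM'H : M'.IsHermitian := Matrix.isHermitian_conjTranspose_mul_mul _ hM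
  let Bl : Fin 2 → Fin 2 → Matrix n n ℂ := fun i j => Matrix.of fun a b => M' (i, a) (j, b)
  have hBlH : ∀ i j, (Bl i j)ᴴ = Bl j i := fun i j => by
    ext a b
    exact congrFun (congrFun hM'H (j, a)) (i, b)
  have hform : ∀ i j (x y : EuclideanSpace ℂ n), star x.ofLp ⬝ᵥ Bl i j *ᵥ y.ofLp =
      inner ℂ (rotatedEmbedding (blockEmbedding n 0) (blockEmbedding n 1) (φ i) x)
        (Matrix.toEuclideanCLM (𝕜 := ℂ) (M - (δ : ℂ) • 1)
          (rotatedEmbedding (blockEmbedding n 0) (blockEmbedding n 1) (φ j) y)) +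
      (if i = j then (δ : ℂ) * (star x.ofLp ⬝ᵥ y.ofLp) else 0) := by
    intro i j x y
    have hR : ∀ (i : Fin 2) (x : EuclideanSpace ℂ n),
        (rotatedEmbedding (blockEmbedding n 0) (blockEmbedding n 1) (φ i) x).ofLp =
          K *ᵥ blockVec i x.ofLp := fun i x => by
      ext ⟨k, a⟩
      simp only [rotatedEmbedding, blockEmbedding_apply, add_apply, smul_apply, PiLp.add_apply,
        PiLp.smul_apply, Matrix.mulVec, dotProduct, hK, Matrix.kroneckerMap_apply,
        Fintype.sum_prod_type, Matrix.one_apply, blockVec, Fin.sum_univ_two]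
      fin_cases k <;> fin_cases i <;> simp [hG]
    have hst : ∀ (N : Matrix (Fin 2 × n) (Fin 2 × n) ℂ) (u w : Fin 2 × n → ℂ),
        star (K *ᵥ u) ⬝ᵥ N *ᵥ (K *ᵥ w) = star u ⬝ᵥ (Kᴴ * N * K) *ᵥ w := fun N u w => by
      rw [Matrix.star_mulVec, ← Matrix.dotProduct_mulVec, Matrix.mulVec_mulVec,
        Matrix.mulVec_mulVec, Matrix.mul_assoc]
    have hone : (if i = j then (δ : ℂ) * (star x.ofLp ⬝ᵥ y.ofLp) else 0) =
        (δ : ℂ) * (star (blockVec i x.ofLp) ⬝ᵥ (1 : Matrix (Fin 2 × n) (Fin 2 × n) ℂ) *ᵥ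
          blockVec j y.ofLp) := by
      rw [star_blockVec_dotProduct_mulVec]
      split_ifs with hij
      · subst hij
        congr 2
        rw [show (Matrix.of fun a b => (1 : Matrix (Fin 2 × n) (Fin 2 × n) ℂ) (i, a) (i, b)) = 1 by
          ext a b; simp [Matrix.one_apply], Matrix.one_mulVec]
      · rw [show (Matrix.of fun a b => (1 : Matrix (Fin 2 × n) (Fin 2 × n) ℂ) (i, a) (j, b)) = 0 by
          ext a b; simp [hij]]
        simp
    rw [inner_toEuclideanCLM, hR, hR, hst, hone, ← star_blockVec_dotProduct_mulVec, Matrix.mul_sub,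
      Matrix.sub_mul, ← hM', Matrix.mul_smul, Matrix.smul_mul, Matrix.mul_one, hKK,
      Matrix.sub_mulVec, dotProduct_sub, Matrix.smul_mulVec, dotProduct_smul, smul_eq_mul,
      sub_add_cancel]
  have hsplit : M' = blockMatrix (Bl 0 0) (Bl 0 1) (Bl 0 1)ᴴ (Bl 1 1) := by
    rw [hBlH]
    ext ⟨i, a⟩ ⟨j, b⟩
    fin_cases i <;> fin_cases j <;> rfl
  have hdiag : ∀ (i : Fin 2) (α : ℝ), (∀ x : EuclideanSpace ℂ n, α * ‖x‖ ^ 2 ≤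
      (inner ℂ (rotatedEmbedding (blockEmbedding n 0) (blockEmbedding n 1) (φ i) x)
        (Matrix.toEuclideanCLM (𝕜 := ℂ) (M - (δ : ℂ) • 1)
          (rotatedEmbedding (blockEmbedding n 0) (blockEmbedding n 1) (φ i) x))).re) →
      (Bl i i - ((α + δ : ℝ) : ℂ) • 1).PosSemidef := fun i α h => by
    refine posSemidef_of_re_nonneg ?_ fun x => ?_
    · refine Matrix.IsHermitian.sub (hBlH i i) ?_
      rw [Matrix.IsHermitian, Matrix.conjTranspose_smul, Matrix.conjTranspose_one]
      simp
    · rw [Matrix.sub_mulVec, dotProduct_sub, Matrix.smul_mulVec, Matrix.one_mulVec,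
        dotProduct_smul, hform i i (WithLp.toLp 2 x) (WithLp.toLp 2 x), if_pos rfl,
        star_dotProduct_self_eq, smul_eq_mul, ← Complex.ofReal_mul, ← Complex.ofReal_mul,
        Complex.sub_re, Complex.add_re, Complex.ofReal_re, Complex.ofReal_re]
      have := h (WithLp.toLp 2 x)
      linarith
  have hM'mem : M' ∈ separableCone (Fin 2) n := by
    rw [hsplit]
    refine blockMatrix_mem (add_pos hα hδ) (add_pos hβ hδ) (hdiag 0 α hA) (hdiag 1 β hC) ?_
    refine blockMatrix_scalar_posDef hα.le hβ.le hδ fun x y => ?_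
    rw [hform, if_neg (by decide), add_zero]
    exact hB x y
  have := conj_mem_separableCone Gᴴ hM'mem
  have hKH : Gᴴ ⊗ₖ (1 : Matrix n n ℂ) = Kᴴ := by
    rw [hK, Matrix.conjTranspose_kronecker, Matrix.conjTranspose_one]
  rw [hKH, Matrix.conjTranspose_conjTranspose, hM'] at this
  convert this using 1
  rw [Matrix.mul_assoc, Matrix.mul_assoc, Matrix.mul_assoc, hKK', Matrix.mul_one, ← Matrix.mul_assoc,
    hKK', Matrix.one_mul]

end Bridge

/-! ### Variational eigenvalue bounds and their stability. -/

section KyFan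

variable {H : Type*} [NormedAddCommGroup H] [InnerProductSpace ℂ H]

/-- The variational bounds hold for the eigenvalues of a diagonalised operator. -/
lemma SpectralBounds.of_eigenbasis {ι : Type*} [Fintype ι] (v : OrthonormalBasis ι ℂ H)
    {T : H →L[ℂ] H} {μ : ι → ℝ} (hT : ∀ i, T (v i) = (μ i : ℂ) • v i) {l b c e : ℝ} {i₀ i₁ : ι}
    (hl : ∀ i, μ i ≤ l) (h₀ : e ≤ μ i₀) (h₁ : c ≤ μ i₁) (h : ∀ i, i ≠ i₀ → i ≠ i₁ → b ≤ μ i)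
    (hec : e ≤ c) (hcb : c ≤ b) : SpectralBounds T l b c e := by
  classical
  have hinner : ∀ x y, inner ℂ x (T y) = ∑ i, (μ i : ℂ) * (inner ℂ x (v i) * inner ℂ (v i) y) :=
    fun x y => by
      conv_lhs => rw [← v.sum_repr' y]
      simp only [map_sum, map_smul, hT, inner_sum, inner_smul_right]
      exact Finset.sum_congr rfl fun i _ => by ring
  have hquad : ∀ x, (inner ℂ x (T x)).re = ∑ i, μ i * ‖inner ℂ (v i) x‖ ^ 2 := fun x => by
    rw [hinner, Complex.re_sum]
    refine Finset.sum_congr rfl fun i _ => ?_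
    rw [Complex.re_ofReal_mul, ← inner_conj_symm x, Complex.conj_mul']
    norm_cast
  have hone : ∀ x : H, ‖x‖ = 1 → ∑ i, ‖inner ℂ (v i) x‖ ^ 2 = 1 := fun x hx => by
    rw [v.sum_sq_norm_inner_right, hx, one_pow]
  have hbessel : ∀ {N : ℕ} (u : Fin N → H), Orthonormal ℂ u → ∀ i,
      ∑ k, ‖inner ℂ (v i) (u k)‖ ^ 2 ≤ 1 := fun u hu i => by
    have := hu.sum_inner_products_le (v i) (s := Finset.univ)
    rw [v.orthonormal.1 i, one_pow] at this
    refine le_trans (le_of_eq (Finset.sum_congr rfl fun k _ => ?_)) this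
    rw [norm_inner_symm]
  -- All eigenvalues except the one at `i₀` are lowered to `c`. Summed over an orthonormal pair,
  -- Bessel's inequality caps the total weight on `v i₀` by one; `hlow₂` does the same for triples.
  have hlow₁ : ∀ x : H, ‖x‖ = 1 → c - (c - e) * ‖inner ℂ (v i₀) x‖ ^ 2 ≤ (inner ℂ x (T x)).re :=
    fun x hx => by
      have hsum : ∑ i, (c - (if i = i₀ then c - e else 0)) * ‖inner ℂ (v i) x‖ ^ 2 =
          c - (c - e) * ‖inner ℂ (v i₀) x‖ ^ 2 := by
        simp only [sub_mul, Finset.sum_sub_distrib, ite_mul, zero_mul, Finset.sum_ite_eq',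
          Finset.mem_univ, if_true, ← Finset.mul_sum, hone x hx, mul_one]
      rw [hquad, ← hsum]
      refine Finset.sum_le_sum fun i _ => mul_le_mul_of_nonneg_right ?_ (sq_nonneg _)
      split_ifs with hi
      · subst hi; linarith
      · by_cases hi' : i = i₁
        · subst hi'; linarith
        · linarith [h i hi hi']
  have hlow₂ : ∀ x : H, ‖x‖ = 1 → b - (b - c) * ‖inner ℂ (v i₁) x‖ ^ 2 -
      (b - e) * ‖inner ℂ (v i₀) x‖ ^ 2 ≤ (inner ℂ x (T x)).re := fun x hx => by
    have hsum : ∑ i, (b - (if i = i₁ then b - c else 0) - (if i = i₀ then b - e else 0)) *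
        ‖inner ℂ (v i) x‖ ^ 2 =
        b - (b - c) * ‖inner ℂ (v i₁) x‖ ^ 2 - (b - e) * ‖inner ℂ (v i₀) x‖ ^ 2 := by
      simp only [sub_mul, Finset.sum_sub_distrib, ite_mul, zero_mul, Finset.sum_ite_eq',
        Finset.mem_univ, if_true, ← Finset.mul_sum, hone x hx, mul_one]
    rw [hquad, ← hsum]
    refine Finset.sum_le_sum fun i _ => mul_le_mul_of_nonneg_right ?_ (sq_nonneg _)
    split_ifs with hi hi' hi'
    · subst hi; linarith
    · subst hi; linarith
    · subst hi'; linarith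
    · linarith [h i hi' hi]
  refine ⟨fun x y => ?_, fun x hx => ?_, fun x hx => ?_, fun u hu => ?_, fun u hu => ?_⟩
  · rw [hinner, ← inner_conj_symm, hinner, map_sum]
    refine Finset.sum_congr rfl fun i _ => ?_
    rw [map_mul, map_mul, inner_conj_symm, inner_conj_symm, Complex.conj_ofReal]
    ring
  · rw [hquad]
    calc ∑ i, μ i * ‖inner ℂ (v i) x‖ ^ 2 ≤ ∑ i, l * ‖inner ℂ (v i) x‖ ^ 2 :=
          Finset.sum_le_sum fun i _ => mul_le_mul_of_nonneg_right (hl i) (sq_nonneg _)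
      _ = l := by rw [← Finset.mul_sum, hone x hx, mul_one]
  · have h1 := hlow₁ x hx
    have h2 : ‖inner ℂ (v i₀) x‖ ^ 2 ≤ 1 := by
      rw [← hone x hx]
      exact Finset.single_le_sum (f := fun i => ‖inner ℂ (v i) x‖ ^ 2)
        (fun i _ => sq_nonneg _) (Finset.mem_univ i₀)
    nlinarith
  · have h1 := Finset.sum_le_sum fun k (_ : k ∈ Finset.univ) => hlow₁ (u k) (hu.1 k)
    have h2 := hbessel u hu i₀
    rw [Finset.sum_sub_distrib, ← Finset.mul_sum] at h1
    simp only [Finset.sum_const, Finset.card_univ, Fintype.card_fin, nsmul_eq_mul] at h1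
    push_cast at h1
    nlinarith
  · have h1 := Finset.sum_le_sum fun k (_ : k ∈ Finset.univ) => hlow₂ (u k) (hu.1 k)
    have h2 := hbessel u hu i₀
    have h3 := hbessel u hu i₁
    rw [Finset.sum_sub_distrib, Finset.sum_sub_distrib, ← Finset.mul_sum, ← Finset.mul_sum] at h1
    simp only [Finset.sum_const, Finset.card_univ, Fintype.card_fin, nsmul_eq_mul] at h1
    push_cast at h1
    nlinarith [mul_le_mul_of_nonneg_left h2 (show 0 ≤ b - e by linarith),
      mul_le_mul_of_nonneg_left h3 (sub_nonneg.2 hcb)]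

/-- The variational bounds are stable under small symmetric perturbations. -/
lemma SpectralBounds.perturb {T T' : H →L[ℂ] H} {l b c e ε : ℝ} (hT : SpectralBounds T l b c e)
    (hT' : ∀ u v, inner ℂ u (T' v) = inner ℂ (T' u) v) (hε : ‖T' - T‖ ≤ ε) :
    SpectralBounds T' (l + ε) (b - ε) (c - ε) (e - ε) := by
  have hclose : ∀ x : H, ‖x‖ = 1 → |(inner ℂ x (T' x)).re - (inner ℂ x (T x)).re| ≤ ε :=
    fun x hx => by
      rw [← Complex.sub_re, ← inner_sub_right, ← sub_apply]
      calc _ ≤ ‖inner ℂ x ((T' - T) x)‖ := Complex.abs_re_le_norm _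
        _ ≤ ‖x‖ * ‖(T' - T) x‖ := norm_inner_le_norm _ _
        _ ≤ ‖x‖ * (‖T' - T‖ * ‖x‖) := by gcongr; exact (T' - T).le_opNorm x
        _ ≤ ε := by rw [hx]; linarith
  refine ⟨hT', fun x hx => ?_, fun x hx => ?_, fun u hu => ?_, fun u hu => ?_⟩
  · linarith [hT.le_top x hx, (abs_le.1 (hclose x hx)).2]
  · linarith [hT.le_one x hx, (abs_le.1 (hclose x hx)).1]
  · have h1 := hT.le_two u hu
    have h2 := fun k => (abs_le.1 (hclose (u k) (hu.1 k))).1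
    rw [Fin.sum_univ_two] at h1 ⊢
    linarith [h2 0, h2 1]
  · have h1 := hT.le_three u hu
    have h2 := fun k => (abs_le.1 (hclose (u k) (hu.1 k))).1
    rw [Fin.sum_univ_three] at h1 ⊢
    linarith [h2 0, h2 1, h2 2]

/-- The variational bounds are invariant under unitary conjugation. -/
lemma SpectralBounds.conj {T T' W : H →L[ℂ] H} {l b c e : ℝ} (hT : SpectralBounds T l b c e)
    (hW : ∀ u v, inner ℂ (W u) (W v) = inner ℂ u v)
    (hT' : ∀ u v, inner ℂ u (T' v) = inner ℂ (W u) (T (W v))) : SpectralBounds T' l b c e := by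
  have hn : ∀ u, ‖W u‖ = ‖u‖ := fun u => by
    rw [@norm_eq_sqrt_re_inner ℂ, hW, ← @norm_eq_sqrt_re_inner ℂ]
  have ho : ∀ {N : ℕ} (u : Fin N → H), Orthonormal ℂ u → Orthonormal ℂ (W ∘ u) := fun u hu =>
    ⟨fun i => by rw [Function.comp_apply, hn, hu.1], fun i j hij => by
      change inner ℂ (W (u i)) (W (u j)) = 0
      rw [hW]; exact hu.2 hij⟩
  refine ⟨fun x y => ?_, fun x hx => ?_, fun x hx => ?_, fun u hu => ?_, fun u hu => ?_⟩
  · rw [hT', hT.isSymmetric, ← inner_conj_symm, ← hT', inner_conj_symm]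
  · rw [hT']; exact hT.le_top _ (by rw [hn, hx])
  · rw [hT']; exact hT.le_one _ (by rw [hn, hx])
  · simp only [hT']; exact hT.le_two _ (ho u hu)
  · simp only [hT']; exact hT.le_three _ (ho u hu)

end KyFan

/-! ### Spectral bounds for states and absolute separability nearby. -/

section States

variable {d : ℕ}

lemma decEig_antitone (ρ : QState (Fin 2 × Fin d)) : Antitone (decEig ρ) := fun i j hij =>
  ρ.2.1.isHermitian.eigenvalues₀_antitone (show Fin.cast _ i ≤ Fin.cast _ j from hij)

/-- The indexing of the eigenvalues by basis vectors that defines `Matrix.IsHermitian.eigenvalues`. -/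
noncomputable def eigenIndex (d : ℕ) : Fin (2 * d) ≃ Fin 2 × Fin d :=
  (finCongr (by simp)).trans (Fintype.equivOfCardEq (Fintype.card_fin _))

lemma eigenvalues_eigenIndex (ρ : QState (Fin 2 × Fin d)) (k : Fin (2 * d)) :
    ρ.2.1.isHermitian.eigenvalues (eigenIndex d k) = decEig ρ k := by
  simp only [Matrix.IsHermitian.eigenvalues, decEig, eigenIndex, Equiv.trans_apply, finCongr_apply,
    Equiv.symm_apply_apply]

lemma decEig_nonneg (ρ : QState (Fin 2 × Fin d)) (k : Fin (2 * d)) : 0 ≤ decEig ρ k := by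
  rw [← eigenvalues_eigenIndex]
  exact ρ.2.1.eigenvalues_nonneg _

lemma spectralBounds_state (ρ : QState (Fin 2 × Fin d)) {p q r s : Fin (2 * d)} (hp : (p : ℕ) = 0)
    (hq : (q : ℕ) + 3 = 2 * d) (hr : (r : ℕ) + 2 = 2 * d) (hs : (s : ℕ) + 1 = 2 * d) :
    SpectralBounds (Matrix.toEuclideanCLM (𝕜 := ℂ) ρ.1) (decEig ρ p) (decEig ρ q) (decEig ρ r)
      (decEig ρ s) := by
  set hH := ρ.2.1.isHermitian
  set τ := eigenIndex d
  have hτ : ∀ k, hH.eigenvalues (τ k) = decEig ρ k := eigenvalues_eigenIndex ρ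
  refine SpectralBounds.of_eigenbasis hH.eigenvectorBasis (μ := hH.eigenvalues)
    (i₀ := τ s) (i₁ := τ r) (fun i => ?_) (fun i => ?_) (hτ _).ge (hτ _).ge (fun i h0 h1 => ?_) ?_ ?_
  · have := hH.mulVec_eigenvectorBasis i
    ext a
    have h2 := congrFun this a
    exact h2
  · obtain ⟨k, rfl⟩ := τ.surjective i
    rw [hτ]
    exact decEig_antitone ρ (Fin.le_def.2 (hp ▸ Nat.zero_le _))
  · obtain ⟨k, rfl⟩ := τ.surjective i
    rw [hτ]
    refine decEig_antitone ρ (Fin.le_def.2 ?_)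
    have h0' : (k : ℕ) ≠ s := fun h => h0 (congrArg τ (Fin.ext h))
    have h1' : (k : ℕ) ≠ r := fun h => h1 (congrArg τ (Fin.ext h))
    have := k.2
    omega
  · exact decEig_antitone ρ (Fin.le_def.2 (by omega))
  · exact decEig_antitone ρ (Fin.le_def.2 (by omega))

lemma exists_slack {l b c e : ℝ} (hb : 0 < b) (he : 0 < e) (hl : l < c + 2 * √(b * e)) :
    ∃ η : ℝ, 0 < η ∧ 0 ≤ b - η ∧ 0 < e - η ∧ l + η ≤ c - η + 2 * √((b - η) * (e - η)) := by
  have h1 : ∀ᶠ η in nhdsWithin (0 : ℝ) (Set.Ioi 0), 0 < b - η ∧ 0 < e - η ∧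
      0 < c - η + 2 * √((b - η) * (e - η)) - (l + η) := by
    refine Filter.Eventually.filter_mono nhdsWithin_le_nhds ?_
    refine (ContinuousAt.eventually_lt (g := fun η => b - η) continuousAt_const (by fun_prop)
      (by simpa using hb)).and ((ContinuousAt.eventually_lt (g := fun η => e - η)
      continuousAt_const (by fun_prop) (by simpa using he)).and (ContinuousAt.eventually_lt
      (g := fun η => c - η + 2 * √((b - η) * (e - η)) - (l + η)) continuousAt_const (by fun_prop)
      (by simpa using hl)))
  obtain ⟨η, ⟨h2, h3, h4⟩, hη⟩ := (h1.and self_mem_nhdsWithin).exists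
  exact ⟨η, hη, h2.le, h3, by linarith⟩

/-- States near a state that satisfies the strict eigenvalue inequality are absolutely separable. -/
lemma exists_norm_lt_imp_mem_absSep (hd : 2 ≤ d) (ρ : QState (Fin 2 × Fin d)) {l b c e : ℝ}
    (hρ : SpectralBounds (Matrix.toEuclideanCLM (𝕜 := ℂ) ρ.1) l b c e) (hb : 0 < b) (he : 0 < e)
    (hl : l < c + 2 * √(b * e)) :
    ∃ ε > 0, ∀ ρ' : QState (Fin 2 × Fin d),
      ‖Matrix.toEuclideanCLM (𝕜 := ℂ) (ρ'.1 - ρ.1)‖ < ε → ρ' ∈ absSep d := by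
  obtain ⟨η, hη, hbη, heη, hlη⟩ := exists_slack hb he hl
  -- Half of the slack pays for the perturbation, the other half for the shift `δ` that separability
  -- requires.
  refine ⟨η / 2, half_pos hη, fun ρ' hρ' U => isSeparable_of_mem_separableCone _ ?_⟩
  have hU : (U : Matrix (Fin 2 × Fin d) (Fin 2 × Fin d) ℂ) * (U : Matrix _ _ ℂ)ᴴ = 1 :=
    Unitary.mul_star_self_of_mem U.2
  have hsub : SpectralBounds (Matrix.toEuclideanCLM (𝕜 := ℂ) (ρ'.1 - ((η / 2 : ℝ) : ℂ) • 1))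
      (l + η) (b - η) (c - η) (e - η) := by
    refine hρ.perturb (fun u v => ?_) ?_
    · rw [inner_toEuclideanCLM, ← inner_conj_symm, inner_toEuclideanCLM, ← Complex.star_def,
        star_star_dotProduct_mulVec]
      congr 2
      rw [Matrix.conjTranspose_sub, ρ'.2.1.isHermitian.eq, Matrix.conjTranspose_smul,
        Matrix.conjTranspose_one]
      simp
    · rw [map_sub, map_smul, map_one, sub_right_comm, ← map_sub]
      refine (norm_sub_le _ _).trans ?_
      rw [norm_smul, Complex.norm_real, Real.norm_of_nonneg (half_pos hη).le]
      have := ContinuousLinearMap.norm_id_le (𝕜 := ℂ) (E := EuclideanSpace ℂ (Fin 2 × Fin d))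
      have h1 : ‖(1 : EuclideanSpace ℂ (Fin 2 × Fin d) →L[ℂ] EuclideanSpace ℂ (Fin 2 × Fin d))‖ ≤ 1 :=
        this
      nlinarith
  refine mem_separableCone_of_spectralBounds (by simpa using Nat.lt_of_succ_le hd) (ρ'.conj U).2.1.isHermitian
    (half_pos hη) (l := l + η) (b := b - η) (c := c - η) (e := e - η) ?_ hbη heη hlη
  refine hsub.conj (W := Matrix.toEuclideanCLM (𝕜 := ℂ) (U : Matrix _ _ ℂ)ᴴ) (fun u v => ?_)
    (fun u v => ?_)
  · rw [← ContinuousLinearMap.adjoint_inner_right, ← ContinuousLinearMap.star_eq_adjoint, ← map_star,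
      Matrix.star_eq_conjTranspose, Matrix.conjTranspose_conjTranspose, ← mul_apply_eq_comp,
      ← map_mul, hU, map_one]
    rfl
  · have hconj : (ρ'.conj U).1 - ((η / 2 : ℝ) : ℂ) • 1 = (U : Matrix _ _ ℂ) *
        (ρ'.1 - ((η / 2 : ℝ) : ℂ) • 1) * (U : Matrix _ _ ℂ)ᴴ := by
      rw [Matrix.mul_sub, Matrix.sub_mul, Matrix.mul_smul, Matrix.smul_mul, Matrix.mul_one, hU]
      rfl
    rw [hconj, map_mul, map_mul, mul_apply_eq_comp, mul_apply_eq_comp,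
      ← ContinuousLinearMap.adjoint_inner_left, ← ContinuousLinearMap.star_eq_adjoint, ← map_star,
      Matrix.star_eq_conjTranspose]

end States

/-! ### Compactness of the absolutely separable set. -/

section Compactness

/-- By Carathéodory, `finrank + 1` points suffice, so the hull is a continuous image of a simplex
times a power of `s`. -/
lemma isCompact_convexHull_of_isCompact {E : Type*} [AddCommGroup E] [Module ℝ E]
    [TopologicalSpace E] [IsTopologicalAddGroup E] [ContinuousSMul ℝ E] [FiniteDimensional ℝ E]
    {s : Set E} (hs : IsCompact s) : IsCompact (convexHull ℝ s) := by
  classical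
  rcases s.eq_empty_or_nonempty with rfl | ⟨z₀, hz₀⟩
  · simp
  let N := Module.finrank ℝ E + 1
  have himg : convexHull ℝ s = (fun p : (Fin N → ℝ) × (Fin N → E) => ∑ i, p.1 i • p.2 i) ''
      (stdSimplex ℝ (Fin N) ×ˢ Set.univ.pi fun _ => s) := by
    apply Set.Subset.antisymm
    · intro x hx
      obtain ⟨ι, _, z, w, hz, hind, hw, hw1, rfl⟩ := eq_pos_convex_span_of_mem_convexHull hx
      have hcard : Fintype.card ι ≤ N := by
        have h1 := hind.card_le_finrank_succ
        have h2 := Submodule.finrank_le (vectorSpan ℝ (Set.range z))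
        omega
      obtain ⟨f⟩ : Nonempty (ι ↪ Fin N) := Function.Embedding.nonempty_of_card_le (by simpa using hcard)
      have hfw : ∀ i, Function.extend f w 0 (f i) = w i := fun i => f.injective.extend_apply _ _ _
      have hfz : ∀ i, Function.extend f z (fun _ => z₀) (f i) = z i := fun i =>
        f.injective.extend_apply _ _ _
      have hf0 : ∀ k, k ∉ Set.range f → Function.extend f w 0 k = 0 := fun k hk =>
        Function.extend_apply' _ _ _ hk
      -- Shorter combinations are padded with weight zero at `z₀`.
      refine ⟨(Function.extend f w 0, Function.extend f z fun _ => z₀), ⟨⟨fun k => ?_, ?_⟩, ?_⟩, ?_⟩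
      · by_cases hk : k ∈ Set.range f
        · obtain ⟨i, rfl⟩ := hk
          exact (hw i).le.trans_eq (hfw i).symm
        · exact (hf0 k hk).ge
      · rw [← hw1]
        exact (Fintype.sum_of_injective f f.injective _ _ hf0 fun i => (hfw i).symm).symm
      · intro k _
        by_cases hk : k ∈ Set.range f
        · obtain ⟨i, rfl⟩ := hk
          simp only [hfz]
          exact hz ⟨i, rfl⟩
        · simp only [Function.extend_apply' _ _ _ hk]
          exact hz₀
      · exact (Fintype.sum_of_injective f f.injective _ _
          (fun k hk => by simp only [hf0 k hk, zero_smul])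
          fun i => by simp only [hfw, hfz]).symm
    · rintro _ ⟨⟨w, z⟩, ⟨hw, hz⟩, rfl⟩
      exact (convex_convexHull ℝ s).sum_mem (fun i _ => hw.1 i) hw.2
        fun i _ => subset_convexHull ℝ s (hz i trivial)
  rw [himg]
  exact ((isCompact_stdSimplex ℝ (Fin N)).prod (isCompact_univ_pi fun _ => hs)).image (by fun_prop)

variable {n : Type} [Fintype n]

omit [Fintype n] in
-- Nonnegativity of a `2 × 2` principal minor; the index map may repeat, so `i = j` needs no
-- separate case.
lemma norm_sq_apply_le_of_posSemidef {M : Matrix n n ℂ} (hM : M.PosSemidef) (i j : n) :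
    ‖M i j‖ ^ 2 ≤ (M i i).re * (M j j).re := by
  have h := (hM.submatrix ![i, j]).det_nonneg
  rw [Matrix.det_fin_two] at h
  simp only [Matrix.submatrix_apply, Matrix.cons_val_zero, Matrix.cons_val_one] at h
  have hji : M j i = star (M i j) := (hM.isHermitian.apply i j).symm ▸ by simp
  have hii := (Complex.le_def.1 (hM.diag_nonneg (i := i))).2
  have hre := (Complex.le_def.1 h).1
  rw [hji, Complex.star_def, Complex.mul_conj', Complex.sub_re, Complex.mul_re, ← hii] at hre
  norm_cast at hre
  simp only [zero_mul, sub_zero] at hre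
  linarith

omit [Fintype n] in
lemma apply_eq_zero_of_posSemidef {M : Matrix n n ℂ} (hM : M.PosSemidef) {i : n} (hi : M i i = 0)
    (j : n) : M i j = 0 := by
  have := norm_sq_apply_le_of_posSemidef hM i j
  rw [hi, Complex.zero_re, zero_mul] at this
  have h0 : ‖M i j‖ = 0 := by nlinarith [norm_nonneg (M i j)]
  exact norm_eq_zero.1 h0

lemma norm_state_apply_le_one (ρ : QState n) (i j : n) : ‖ρ.1 i j‖ ≤ 1 := by
  have hpos : ∀ k, 0 ≤ (ρ.1 k k).re := fun k => (Complex.le_def.1 ρ.2.1.diag_nonneg).1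
  have hle : ∀ k, (ρ.1 k k).re ≤ 1 := fun k => by
    have h1 := congrArg Complex.re ρ.2.2
    rw [Matrix.trace, Complex.re_sum, Complex.one_re] at h1
    rw [← h1]
    exact Finset.single_le_sum (f := fun k => (ρ.1 k k).re) (fun k _ => hpos k) (Finset.mem_univ k)
  have := norm_sq_apply_le_of_posSemidef ρ.2.1 i j
  have h2 : (ρ.1 i i).re * (ρ.1 j j).re ≤ 1 := mul_le_one₀ (hle i) (hpos j) (hle j)
  nlinarith [norm_nonneg (ρ.1 i j)]

lemma isClosed_states : IsClosed {ρ : Matrix n n ℂ | ρ.PosSemidef ∧ ρ.trace = 1} := by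
  have : {ρ : Matrix n n ℂ | ρ.PosSemidef ∧ ρ.trace = 1} =
      {ρ | ρᴴ = ρ} ∩ (⋂ x : n → ℂ, {ρ | 0 ≤ star x ⬝ᵥ ρ *ᵥ x}) ∩ {ρ | ρ.trace = 1} := by
    ext ρ
    simp only [Set.mem_inter_iff, Set.mem_iInter, Set.mem_ofPred_eq,
      Matrix.posSemidef_iff_dotProduct_mulVec, Matrix.IsHermitian]
  rw [this]
  refine IsClosed.inter (IsClosed.inter (isClosed_eq (by fun_prop) (by fun_prop))
    (isClosed_iInter fun x => ?_)) (isClosed_eq (by fun_prop) (by fun_prop))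
  exact isClosed_le continuous_const (by fun_prop)

lemma isCompact_states : IsCompact {ρ : Matrix n n ℂ | ρ.PosSemidef ∧ ρ.trace = 1} := by
  have hc : IsCompact (Set.univ.pi fun _ : n => Set.univ.pi fun _ : n =>
      Metric.closedBall (0 : ℂ) 1) :=
    isCompact_univ_pi fun _ => isCompact_univ_pi fun _ => isCompact_closedBall _ _
  refine IsCompact.of_isClosed_subset (X := Matrix n n ℂ) hc isClosed_states fun ρ hρ => ?_
  intro i _ j _
  simpa using norm_state_apply_le_one ⟨ρ, hρ⟩ i j

instance : CompactSpace (QState n) := isCompact_iff_compactSpace.1 isCompact_states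

lemma isCompact_productStates {m : Type} [Fintype m] :
    IsCompact (productStates m n) := by
  have : productStates m n = Set.range fun p : QState m × QState n => p.1.1 ⊗ₖ p.2.1 := by
    ext τ
    simp [eq_comm]
  rw [this]
  refine isCompact_range ?_
  refine continuous_matrix fun i j => ?_
  simp only [Matrix.kroneckerMap_apply]
  exact ((continuous_subtype_val.comp continuous_fst).matrix_elem _ _).mul
    ((continuous_subtype_val.comp continuous_snd).matrix_elem _ _)

/-- For each fixed unitary the condition is the preimage of a compact convex hull under a continuous
map. -/
lemma isClosed_absSep (d : ℕ) : IsClosed (absSep d) := by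
  have : absSep d = ⋂ U : Matrix.unitaryGroup (Fin 2 × Fin d) ℂ,
      {ρ | (U : Matrix _ _ ℂ) * ρ.1 * (U : Matrix _ _ ℂ)ᴴ ∈
        convexHull ℝ (productStates (Fin 2) (Fin d))} := by
    ext ρ
    simp only [Set.mem_iInter]
    rfl
  rw [this]
  refine isClosed_iInter fun U => ?_
  exact (isCompact_convexHull_of_isCompact isCompact_productStates).isClosed.preimage (by fun_prop)

end Compactness

/-! ### Singular states are not interior. -/

section Boundary

/-- A separable operator with a vanishing diagonal entry has vanishing entries in the corresponding
row of its partial transpose. -/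
lemma apply_eq_zero_of_mem_convexHull {m n : Type} [Fintype m] [Fintype n]
    {M : Matrix (m × n) (m × n) ℂ} (hM : M ∈ convexHull ℝ (productStates m n))
    {i : m} {a : n} (h0 : M (i, a) (i, a) = 0) (j : m) (b : n) : M (i, b) (j, a) = 0 := by
  let PT : Matrix (m × n) (m × n) ℂ → Matrix (m × n) (m × n) ℂ :=
    fun M => Matrix.of fun p q => M (p.1, q.2) (q.1, p.2)
  have hpsd : (PT M).PosSemidef := by
    have hconv : Convex ℝ {M : Matrix (m × n) (m × n) ℂ | (PT M).PosSemidef} := by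
      intro M hM N hN s t hs ht _
      have : PT (s • M + t • N) = s • PT M + t • PT N := rfl
      simp only [Set.mem_ofPred_eq] at hM hN ⊢
      rw [this]
      exact (hM.smul hs).add (hN.smul ht)
    refine convexHull_min ?_ hconv hM
    rintro _ ⟨α, β, rfl⟩
    exact α.2.1.kronecker β.2.1.transpose
  exact apply_eq_zero_of_posSemidef hpsd (i := (i, a)) h0 (j, b)

variable {d : ℕ}

/-- A property of states that holds near `σ` holds along a path of matrices from `σ`, as long as they
are states. -/
lemma exists_mem_of_mem_interior {n : Type} [Fintype n] {S : Set (QState n)} {σ : QState n}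
    (hσ : σ ∈ interior S) {γ : ℝ → Matrix n n ℂ} (hγ : Continuous γ) (h0 : γ 0 = σ.1) {r : ℝ}
    (hr : 0 < r) (hst : ∀ t ∈ Set.Ioo 0 r, (γ t).PosSemidef ∧ (γ t).trace = 1) :
    ∃ (t : ℝ) (ht : t ∈ Set.Ioo 0 r), (⟨γ t, hst t ht⟩ : QState n) ∈ S := by
  rw [mem_interior_iff_mem_nhds, nhds_subtype_eq_comap, Filter.mem_comap] at hσ
  obtain ⟨V, hV, hVS⟩ := hσ
  rw [← h0] at hV
  have h1 : ∀ᶠ t in nhdsWithin (0 : ℝ) (Set.Ioi 0), γ t ∈ V :=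
    (hγ.continuousAt.eventually hV).filter_mono nhdsWithin_le_nhds
  have h2 : ∀ᶠ t in nhdsWithin (0 : ℝ) (Set.Ioi 0), t ∈ Set.Ioo 0 r := Ioo_mem_nhdsGT hr
  obtain ⟨t, ht, htr⟩ := (h1.and h2).exists
  exact ⟨t, htr, hVS ht⟩

/-- A singular state is not in the interior of the set of absolutely separable states. -/
lemma notMem_interior_absSep_of_singular (hd : 2 ≤ d) {σ : QState (Fin 2 × Fin d)}
    (hσ : ¬ σ.1.PosDef) : σ ∉ interior (absSep d) := by
  intro hint
  set a₀ : Fin d := ⟨0, by omega⟩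
  set a₁ : Fin d := ⟨1, by omega⟩
  have ha : a₀ ≠ a₁ := by simp [a₀, a₁]
  -- `V` diagonalises `σ`, with a kernel vector placed at the product basis vector `(0, a₀)`.
  obtain ⟨V, hV0, hV1⟩ : ∃ V : Matrix.unitaryGroup (Fin 2 × Fin d) ℂ,
      (σ.conj V).1 (0, a₀) (0, a₀) = 0 ∧ (σ.conj V).1 (0, a₁) (1, a₀) = 0 := by
    set hH := σ.2.1.isHermitian
    obtain ⟨i, hi⟩ : ∃ i, hH.eigenvalues i = 0 := by
      by_contra! hcon
      exact hσ (hH.posDef_iff_eigenvalues_pos.2 fun i =>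
        lt_of_le_of_ne (σ.2.1.eigenvalues_nonneg i) (hcon i).symm)
    let π : Equiv.Perm (Fin 2 × Fin d) := Equiv.swap (0, a₀) i
    set W : Matrix (Fin 2 × Fin d) (Fin 2 × Fin d) ℂ :=
      (hH.eigenvectorUnitary : Matrix (Fin 2 × Fin d) (Fin 2 × Fin d) ℂ)
    have hWW : Wᴴ * W = 1 := Unitary.star_mul_self_of_mem hH.eigenvectorUnitary.2
    have hspec : σ.1 = W * Matrix.diagonal (fun i => (hH.eigenvalues i : ℂ)) * Wᴴ := by
      conv_lhs => rw [hH.spectral_theorem]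
      rw [Unitary.conjStarAlgAut_apply]
      rfl
    let V : Matrix (Fin 2 × Fin d) (Fin 2 × Fin d) ℂ := Wᴴ.submatrix π id
    have hVH : Vᴴ = W.submatrix id π := by
      rw [Matrix.conjTranspose_submatrix, Matrix.conjTranspose_conjTranspose]
    have hVmul : ∀ A : Matrix (Fin 2 × Fin d) (Fin 2 × Fin d) ℂ,
        V * A * Vᴴ = (Wᴴ * A * W).submatrix π π := fun A => by
      rw [hVH]
      rfl
    have hV : V * Vᴴ = 1 := by
      have := hVmul 1
      rwa [Matrix.mul_one, Matrix.mul_one, hWW, Matrix.submatrix_one_equiv] at this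
    have hdiag : V * σ.1 * Vᴴ =
        (Matrix.diagonal fun i => (hH.eigenvalues i : ℂ)).submatrix π π := by
      rw [hVmul]
      generalize hH.eigenvalues = ev at hspec
      rw [hspec]
      congr 1
      calc _ = (Wᴴ * W) * Matrix.diagonal (fun i => (ev i : ℂ)) * (Wᴴ * W) := by
            simp only [Matrix.mul_assoc]
        _ = _ := by rw [hWW, Matrix.one_mul, Matrix.mul_one]
    refine ⟨⟨V, Matrix.mem_unitaryGroup_iff.2 hV⟩, ?_, ?_⟩
    · change (V * σ.1 * Vᴴ) (0, a₀) (0, a₀) = 0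
      rw [hdiag]
      simp [π, hi]
    · change (V * σ.1 * Vᴴ) (0, a₁) (1, a₀) = 0
      rw [hdiag, Matrix.submatrix_apply, Matrix.diagonal_apply_ne]
      exact fun h => by simpa using π.injective h
  -- An entangled vector with no component at `(0, a₀)`. Admixing it keeps that diagonal entry zero
  -- but makes the entry at `(0, a₁)`, `(1, a₀)` equal to `t / 2`, which partial transposition
  -- forbids for separable operators.
  set φ : Fin 2 × Fin d → ℂ := Pi.single (0, a₁) 1 + Pi.single (1, a₀) 1 with hφ
  let κ : QState (Fin 2 × Fin d) := ⟨(2⁻¹ : ℝ) • Matrix.vecMulVec φ (star φ),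
    (Matrix.posSemidef_vecMulVec_self_star φ).smul (by norm_num), by
      rw [Matrix.trace_smul, Matrix.trace_vecMulVec, hφ, add_dotProduct, single_dotProduct,
        single_dotProduct]
      simp [ha]
      norm_num⟩
  let κ' := κ.conj V⁻¹
  have hstate : ∀ t ∈ Set.Ioo (0 : ℝ) 1, ((1 - t) • σ.1 + t • κ'.1).PosSemidef ∧
      ((1 - t) • σ.1 + t • κ'.1).trace = 1 := fun t ht => by
    refine ⟨(σ.2.1.smul (by linarith [ht.2])).add (κ'.2.1.smul ht.1.le), ?_⟩
    rw [Matrix.trace_add, Matrix.trace_smul, Matrix.trace_smul, σ.2.2, κ'.2.2, ← add_smul]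
    simp
  obtain ⟨t, ht, hmem⟩ := exists_mem_of_mem_interior hint
    (γ := fun t => (1 - t) • σ.1 + t • κ'.1) (by fun_prop) (by simp) one_pos hstate
  have hsep : (V : Matrix _ _ ℂ) * ((1 - t) • σ.1 + t • κ'.1) * (V : Matrix _ _ ℂ)ᴴ ∈
    convexHull ℝ (productStates (Fin 2) (Fin d)) := hmem V
  have hVV : (V : Matrix (Fin 2 × Fin d) (Fin 2 × Fin d) ℂ) * (V : Matrix _ _ ℂ)ᴴ = 1 :=
    Unitary.mul_star_self_of_mem V.2
  have hκ' : κ'.1 = (V : Matrix _ _ ℂ)ᴴ * κ.1 * (V : Matrix _ _ ℂ) := by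
    change (V : Matrix _ _ ℂ)ᴴ * κ.1 * ((V : Matrix _ _ ℂ)ᴴ)ᴴ = _
    rw [Matrix.conjTranspose_conjTranspose]
  have hval : (V : Matrix _ _ ℂ) * ((1 - t) • σ.1 + t • κ'.1) * (V : Matrix _ _ ℂ)ᴴ =
      (1 - t) • (σ.conj V).1 + t • κ.1 := by
    rw [show (σ.conj V).1 = (V : Matrix _ _ ℂ) * σ.1 * (V : Matrix _ _ ℂ)ᴴ from rfl]
    rw [Matrix.mul_add, Matrix.add_mul, Matrix.mul_smul, Matrix.smul_mul, Matrix.mul_smul,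
      Matrix.smul_mul, hκ']
    congr 2
    calc _ = ((V : Matrix _ _ ℂ) * (V : Matrix _ _ ℂ)ᴴ) * κ.1 *
          ((V : Matrix _ _ ℂ) * (V : Matrix _ _ ℂ)ᴴ) := by simp only [Matrix.mul_assoc]
      _ = _ := by rw [hVV, Matrix.one_mul, Matrix.mul_one]
  rw [hval] at hsep
  have hκ0 : κ.1 (0, a₀) (0, a₀) = 0 := by
    simp [κ, hφ, Matrix.vecMulVec_apply, ha]
  have hκ1 : κ.1 (0, a₁) (1, a₀) = 2⁻¹ := by
    simp [κ, hφ, Matrix.vecMulVec_apply]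
  have := apply_eq_zero_of_mem_convexHull hsep (i := 0) (a := a₀)
    (by rw [Matrix.add_apply, Matrix.smul_apply, Matrix.smul_apply, hV0, hκ0]; simp) 1 a₁
  rw [Matrix.add_apply, Matrix.smul_apply, Matrix.smul_apply, hV1, hκ1] at this
  simp at this
  exact ht.1.ne' this

end Boundary

/-! ### The ray from the maximally mixed state. -/

section Main

lemma Matrix.PosDef.exists_sub_smul_one_posSemidef {n : Type} [Fintype n] [DecidableEq n]
    {M : Matrix n n ℂ} (hM : M.PosDef) : ∃ e : ℝ, 0 < e ∧ (M - e • 1).PosSemidef := by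
  have hH := hM.isHermitian
  have hpos := hH.posDef_iff_eigenvalues_pos.1 hM
  obtain ⟨e, he, hle⟩ : ∃ e : ℝ, 0 < e ∧ ∀ i, e ≤ hH.eigenvalues i := by
    cases isEmpty_or_nonempty n
    · exact ⟨1, one_pos, fun i => isEmptyElim i⟩
    · obtain ⟨i, hi⟩ := Finite.exists_min hH.eigenvalues
      exact ⟨_, hpos i, hi⟩
  refine ⟨e, he, ?_⟩
  set W : Matrix n n ℂ := (hH.eigenvectorUnitary : Matrix n n ℂ)
  have hWW : W * Wᴴ = 1 := Unitary.mul_star_self_of_mem hH.eigenvectorUnitary.2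
  have hspec : M = W * Matrix.diagonal (fun i => (hH.eigenvalues i : ℂ)) * Wᴴ := by
    conv_lhs => rw [hH.spectral_theorem]
    rw [Unitary.conjStarAlgAut_apply]
    rfl
  have hdiag : M - e • 1 = W * Matrix.diagonal (fun i => ((hH.eigenvalues i - e : ℝ) : ℂ)) * Wᴴ := by
    have h1 : Matrix.diagonal (fun i => ((hH.eigenvalues i - e : ℝ) : ℂ)) =
        Matrix.diagonal (fun i => (hH.eigenvalues i : ℂ)) - e • 1 := by
      rw [← Matrix.diagonal_one, ← Matrix.diagonal_smul, Matrix.diagonal_sub]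
      congr 1
      ext i
      simp
    rw [h1, Matrix.mul_sub, Matrix.sub_mul, ← hspec, Matrix.mul_smul, Matrix.smul_mul,
      Matrix.mul_one, hWW]
  rw [hdiag]
  refine (Matrix.PosSemidef.diagonal fun i => ?_).mul_mul_conjTranspose_same W
  exact Complex.zero_le_real.2 (sub_nonneg.2 (hle i))

variable {d : ℕ}

lemma trace_maxMixed (hd : 2 ≤ d) : (maxMixed d).trace = 1 := by
  have : (d : ℂ) ≠ 0 := by exact_mod_cast (by omega : d ≠ 0)
  rw [maxMixed, Matrix.trace_smul, Matrix.trace_one, Complex.real_smul]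
  simp only [Fintype.card_prod, Fintype.card_fin]
  push_cast
  field_simp

/-- An invertible state in the interior of the set of absolutely separable states can be moved
away from the maximally mixed state. -/
lemma exists_mem_absSep_of_mem_interior (hd : 2 ≤ d) {σ : QState (Fin 2 × Fin d)}
    (hσ : σ ∈ interior (absSep d)) (hpd : σ.1.PosDef) :
    ∃ t : ℝ, 0 < t ∧ ∃ τ ∈ absSep d, τ.1 = maxMixed d + (1 + t) • (σ.1 - maxMixed d) := by
  obtain ⟨e, he, hpsd⟩ := hpd.exists_sub_smul_one_posSemidef
  have hd0 : (0 : ℝ) < 2 * d := by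
    have : (0 : ℝ) < d := by exact_mod_cast (by omega : 0 < d)
    positivity
  -- The step subtracts `t / (2d)` times the identity, which the lower bound `e` of `σ` absorbs for
  -- `t` in this range.
  have hst : ∀ t ∈ Set.Ioo (0 : ℝ) (e * (2 * d)),
      (maxMixed d + (1 + t) • (σ.1 - maxMixed d)).PosSemidef ∧
      (maxMixed d + (1 + t) • (σ.1 - maxMixed d)).trace = 1 := fun t ht => by
    constructor
    · have heq : maxMixed d + (1 + t) • (σ.1 - maxMixed d) =
          (σ.1 - e • 1) + (t • σ.1 + (e - t * (2 * d : ℝ)⁻¹) • 1) := by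
        rw [maxMixed]
        module
      rw [heq]
      refine hpsd.add ((σ.2.1.smul ht.1.le).add (Matrix.PosSemidef.one.smul ?_))
      rw [sub_nonneg, ← div_eq_mul_inv, div_le_iff₀ hd0]
      exact ht.2.le
    · rw [Matrix.trace_add, Matrix.trace_smul, Matrix.trace_sub, trace_maxMixed hd, σ.2.2]
      simp
  obtain ⟨t, ht, hmem⟩ := exists_mem_of_mem_interior hσ
    (γ := fun t => maxMixed d + (1 + t) • (σ.1 - maxMixed d)) (by fun_prop) (by simp)
    (by positivity) hst
  exact ⟨t, ht.1, _, hmem, rfl⟩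

/-- Bounded because entries of states have norm at most one, while some entry of `ρ.1 - maxMixed d`
is nonzero. -/
lemma isCompact_ray (ρ : QState (Fin 2 × Fin d)) (hne : ρ.1 ≠ maxMixed d) :
    IsCompact {s : ℝ | 1 ≤ s ∧ ∃ τ ∈ absSep d, τ.1 = maxMixed d + s • (ρ.1 - maxMixed d)} := by
  obtain ⟨i, j, hij⟩ : ∃ i j, (ρ.1 - maxMixed d) i j ≠ 0 := by
    by_contra! h
    exact hne (sub_eq_zero.1 (Matrix.ext h))
  set a := ‖(ρ.1 - maxMixed d) i j‖
  have ha : 0 < a := norm_pos_iff.2 hij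
  refine (isCompact_Icc (a := (1 : ℝ)) (b := (1 + ‖maxMixed d i j‖) / a)).of_isClosed_subset ?_ ?_
  · have hcl : IsClosed (Subtype.val '' absSep d) :=
      ((isClosed_absSep d).isCompact.image continuous_subtype_val).isClosed
    have : {s : ℝ | 1 ≤ s ∧ ∃ τ ∈ absSep d, τ.1 = maxMixed d + s • (ρ.1 - maxMixed d)} =
        Set.Ici 1 ∩ (fun s : ℝ => maxMixed d + s • (ρ.1 - maxMixed d)) ⁻¹'
          (Subtype.val '' absSep d) := rfl
    rw [this]
    exact isClosed_Ici.inter (hcl.preimage (by fun_prop))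
  · rintro s ⟨hs, τ, -, hτ⟩
    refine ⟨hs, ?_⟩
    rw [le_div_iff₀ ha]
    have h1 := norm_state_apply_le_one τ i j
    have h2 : ((s : ℂ) * (ρ.1 - maxMixed d) i j) = τ.1 i j - maxMixed d i j := by
      rw [hτ, Matrix.add_apply, Matrix.smul_apply, Complex.real_smul]
      ring
    have h3 := congrArg norm h2
    rw [norm_mul, Complex.norm_real, Real.norm_of_nonneg (by linarith)] at h3
    rw [h3]
    exact (norm_sub_le _ _).trans (by linarith)

lemma mem_interior_absSep (hd : 2 ≤ d) (ρ : QState (Fin 2 × Fin d)) {l b c e : ℝ}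
    (hρ : SpectralBounds (Matrix.toEuclideanCLM (𝕜 := ℂ) ρ.1) l b c e) (hb : 0 < b) (he : 0 < e)
    (hl : l < c + 2 * √(b * e)) : ρ ∈ interior (absSep d) := by
  obtain ⟨ε, hε, h⟩ := exists_norm_lt_imp_mem_absSep hd ρ hρ hb he hl
  refine mem_interior.2 ⟨{ρ' | ‖Matrix.toEuclideanCLM (𝕜 := ℂ) (ρ'.1 - ρ.1)‖ < ε}, h, ?_, ?_⟩
  · have hc : Continuous (Matrix.toEuclideanCLM (n := Fin 2 × Fin d) (𝕜 := ℂ)) :=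
      (Matrix.toEuclideanCLM (n := Fin 2 × Fin d) (𝕜 := ℂ)).toAlgEquiv.toLinearMap.continuous_of_finiteDimensional
    exact isOpen_lt (hc.comp (continuous_subtype_val.sub continuous_const)).norm continuous_const
  · simpa using hε

end Main

theorem corollary2 (d : ℕ) (hd : 2 ≤ d) (ρ : QState (Fin 2 × Fin d))
    (hρ : ρ ∈ absSep d) (hne : ρ.1 ≠ maxMixed d)
    (hlt : decEig ρ ⟨0, by omega⟩ - decEig ρ ⟨2 * d - 2, by omega⟩ <
      2 * √(decEig ρ ⟨2 * d - 3, by omega⟩ * decEig ρ ⟨2 * d - 1, by omega⟩)) :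
    (∃ σ : QState (Fin 2 × Fin d), σ ∈ absSep d ∧ σ ∈ frontier (absSep d) ∧
      ∃ t : ℝ, 0 < t ∧ t < 1 ∧ ρ.1 = t • maxMixed d + (1 - t) • σ.1) ∧
    ρ ∈ interior (absSep d) := by
  have hb0 := decEig_nonneg ρ ⟨2 * d - 3, by omega⟩
  have he0 := decEig_nonneg ρ ⟨2 * d - 1, by omega⟩
  have hcl := decEig_antitone ρ (a := ⟨0, by omega⟩) (b := ⟨2 * d - 2, by omega⟩)
    (Fin.le_def.2 (Nat.zero_le _))
  -- The left side of the inequality is nonnegative, so the square root is positive; this forces the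
  -- smallest eigenvalue to be positive and makes `ρ` invertible.
  have hbe := Real.sqrt_pos.1 (pos_of_mul_pos_right ((sub_nonneg.2 hcl).trans_lt hlt) zero_le_two)
  have hb := pos_of_mul_pos_left hbe he0
  have he := pos_of_mul_pos_right hbe hb0
  have hbounds := spectralBounds_state ρ (p := ⟨0, by omega⟩) (q := ⟨2 * d - 3, by omega⟩)
    (r := ⟨2 * d - 2, by omega⟩) (s := ⟨2 * d - 1, by omega⟩) rfl (Nat.sub_add_cancel (by omega))
    (Nat.sub_add_cancel (by omega)) (Nat.sub_add_cancel (by omega))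
  have hint : ρ ∈ interior (absSep d) := mem_interior_absSep hd ρ hbounds hb he (by linarith)
  refine ⟨?_, hint⟩
  have hpd : ρ.1.PosDef := by
    refine ρ.2.1.isHermitian.posDef_iff_eigenvalues_pos.2 fun i => ?_
    obtain ⟨k, rfl⟩ := (eigenIndex d).surjective i
    rw [eigenvalues_eigenIndex]
    exact he.trans_le (decEig_antitone ρ (Fin.le_def.2 (Nat.le_sub_one_of_lt k.2)))
  -- `σ` is the last absolutely separable point on the ray. It equals `maxMixed d + s • (ρ.1 -
  -- maxMixed d)`, so solving for `ρ` gives the weight `1 - s⁻¹` on the maximally mixed state.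
  obtain ⟨s, ⟨hs1, σ, hσ, hσs⟩, hmax⟩ := (isCompact_ray ρ hne).exists_isGreatest
    ⟨1, le_rfl, ρ, hρ, by simp⟩
  have hs : 1 < s := by
    obtain ⟨t, ht, τ, hτ, hτt⟩ := exists_mem_absSep_of_mem_interior hd hint hpd
    linarith [hmax ⟨by linarith, τ, hτ, hτt⟩]
  have hσint : σ ∉ interior (absSep d) := fun hσi => by
    have hσpd : σ.1.PosDef := by
      by_contra h
      exact notMem_interior_absSep_of_singular hd h hσi
    obtain ⟨t, ht, τ, hτ, hτt⟩ := exists_mem_absSep_of_mem_interior hd hσi hσpd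
    have hts : s < (1 + t) * s := by nlinarith
    refine hts.not_ge (hmax ⟨by linarith, τ, hτ, ?_⟩)
    rw [hτt, hσs, add_sub_cancel_left, smul_smul]
  have hs0 : s ≠ 0 := by linarith
  refine ⟨σ, hσ, (isClosed_absSep d).frontier_eq ▸ ⟨hσ, hσint⟩, 1 - s⁻¹,
    sub_pos.2 (inv_lt_one_of_one_lt₀ hs), by linarith [inv_pos.2 (by linarith : 0 < s)], ?_⟩
  rw [hσs, sub_sub_cancel, smul_add, smul_smul, inv_mul_cancel₀ hs0]
  module
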